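/- Let $m\ge 0$ and let $a_1,\dots,a_m$ be operators on a complex Hilbert space $\mathcal H\cong\mathbb C^{2^m}$ with $\{a_j,a_k\}=0$ and $\{a_j,a_k^\dagger\}=\delta_{jk}I$. Let $c_{2k-1}=a_k+a_k^\dagger$ and $c_{2k}=-i(a_k^\dagger-a_k)$ be the $2m$ Majorana operators, and let $\Lambda=\sum_{i=1}^{2m}c_i\otimes c_i$ act on $\mathcal H\otimes\mathcal H$. Every real orthogonal matrix $R\in O(2m)$ is induced by some unitary $U_R$ on $\mathcal H$, i.e. $U_Rc_iU_R^\dagger=\sum_jR_{ij}c_j$ for all $i$. For any choice of such unitaries $U_R$, let the FLO (fermionic linear optics) twirl be $$\mathcal S(X)=\int_{O(2m)}(U_R\otimes U_R)\,X\,(U_R^\dagger\otimes U_R^\dagger)\,dR,$$ where $dR$ is the Haar measure of total mass $1$ on $O(2m)$; the integrand is integrable for every operator $X$ on $\mathcal H\otimes\mathcal H$. A Gaussian state is an operator of the form $\rho=2^{-m}\prod_{k=1}^m(I+i\lambda_k\tilde c_{2k-1}\tilde c_{2k})$ with $\lambda_k\in[-1,1]$ and $\tilde c_i=\sum_jR_{ij}c_j$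 for some $R\in SO(2m)$; a unit vector $\psi$ is pure Gaussian if $|\psi\rangle\langle\psi|$ is a Gaussian state. A vacuum state is a unit vector $|0\rangle$ annihilated by all the annihilation operators $\tilde a_k=\tfrac12(\tilde c_{2k-1}-i\tilde c_{2k})$, $k=1,\dots,m$, belonging to some set of rotated Majorana operators $\tilde c_i=\sum_jR_{ij}c_j$ with $R\in O(2m)$. Write $|\psi,\psi\rangle=|\psi\rangle\otimes|\psi\rangle$. 1. For every vacuum state $|0\rangle$, the orthogonal projector onto the null space of $\Lambda$ is $$\Pi_{\Lambda=0}=\binom{2m}{m}\,\mathcal S\big(|0,0\rangle\langle 0,0|\big).$$ 2. The null space of $\Lambda$ is the linear span of the vectors $|\psi,\psi\rangle$ with $\psi$ pure Gaussian. 3. The null space of $\Lambda$ is contained in the symmetric subspace of $\mathcal H\otimes\mathcal H$, i.e. the set of vectors fixed by the swap operator $|x,y\rangle\mapsto|y,x\rangle$. -/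

import Mathlib

open scoped Matrix Kronecker

/-- `m` fermionic modes: the operators `a₁, …, aₘ` satisfy the canonical anticommutation relations
`{aⱼ, aₖ} = 0` and `{aⱼ, aₖ†} = δⱼₖ I`. -/
structure IsFermionicModes {m : ℕ} {n : Type*} [Fintype n] [DecidableEq n]
    (a : Fin m → Matrix n n ℂ) : Prop where
  anticomm : ∀ j k, a j * a k + a k * a j = 0
  anticomm_conjTranspose : ∀ j k, a j * (a k)ᴴ + (a k)ᴴ * a j = if j = k then 1 else 0

/-- The Fock space representation on `ℂ^(2^m)`, in the occupation number basis indexed by the sets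
`S` of occupied modes: `aₖ |T⟩ = (-1)^#{j ∈ T : j < k} |T \ {k}⟩` if `k ∈ T`, and `aₖ |T⟩ = 0`
otherwise. -/
noncomputable def fockAnnihilation (m : ℕ) (k : Fin m) :
    Matrix (Finset (Fin m)) (Finset (Fin m)) ℂ :=
  Matrix.of fun S T =>
    if k ∉ S ∧ T = insert k S then (-1) ^ (S.filter (· < k)).card else 0

/-- The Fock space representation satisfies the canonical anticommutation relations. -/
theorem isFermionicModes_fockAnnihilation (m : ℕ) : IsFermionicModes (fockAnnihilation m) := by
  have L : ∀ (k : Fin m) (M : Matrix (Finset (Fin m)) (Finset (Fin m)) ℂ) S T,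
      (fockAnnihilation m k * M) S T =
        if k ∉ S then (-1) ^ (S.filter (· < k)).card * M (insert k S) T else 0 := by
    intro k M S T
    by_cases h : k ∉ S <;> simp [Matrix.mul_apply, fockAnnihilation, h]
  have L' : ∀ (k : Fin m) (M : Matrix (Finset (Fin m)) (Finset (Fin m)) ℂ) S T,
      ((fockAnnihilation m k)ᴴ * M) S T =
        if k ∈ S then (-1) ^ (S.filter (· < k)).card * M (S.erase k) T else 0 := by
    intro k M S T
    by_cases h : k ∈ S
    · have e : ∀ R : Finset (Fin m), (k ∉ R ∧ S = insert k R) ↔ R = S.erase k := by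
        intro R
        constructor
        · rintro ⟨h1, rfl⟩
          simp [h1]
        · rintro rfl
          simp [h]
      have f : (S.erase k).filter (· < k) = S.filter (· < k) := by
        ext x
        simp only [Finset.mem_filter, Finset.mem_erase]
        exact ⟨fun hx => ⟨hx.1.2, hx.2⟩, fun hx => ⟨⟨hx.2.ne, hx.1⟩, hx.2⟩⟩
      simp [Matrix.mul_apply, fockAnnihilation, e, h, f, apply_ite (star : ℂ → ℂ)]
    · have e : ∀ R : Finset (Fin m), ¬ (k ∉ R ∧ S = insert k R) := by
        rintro R ⟨-, rfl⟩
        simp at h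
      simp [Matrix.mul_apply, fockAnnihilation, e, h]
  have si : ∀ (j k : Fin m) (S : Finset (Fin m)), j ∉ S →
      ((-1 : ℂ)) ^ ((insert j S).filter (· < k)).card =
        (if j < k then -1 else 1) * (-1) ^ (S.filter (· < k)).card := by
    intro j k S h
    rw [Finset.filter_insert]
    split_ifs
    · rw [Finset.card_insert_of_notMem (by simp [h]), pow_succ]
      ring
    · ring
  have se : ∀ (j k : Fin m) (S : Finset (Fin m)), j ∈ S →
      ((-1 : ℂ)) ^ ((S.erase j).filter (· < k)).card =
        (if j < k then -1 else 1) * (-1) ^ (S.filter (· < k)).card := by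
    intro j k S h
    have := si j k (S.erase j) (by simp)
    rw [Finset.insert_erase h] at this
    rw [this, ← mul_assoc]
    split_ifs <;> simp
  have sq : ∀ x : ℕ, ((-1 : ℂ)) ^ x * (-1) ^ x = 1 := fun x => by
    rw [← mul_pow]
    simp
  have one : ∀ (k : Fin m) S T, fockAnnihilation m k S T =
      if k ∉ S then (-1) ^ (S.filter (· < k)).card *
        (1 : Matrix (Finset (Fin m)) (Finset (Fin m)) ℂ) (insert k S) T else 0 := by
    intro k S T
    rw [← L, mul_one]
  have one' : ∀ (k : Fin m) S T, (fockAnnihilation m k)ᴴ S T =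
      if k ∈ S then (-1) ^ (S.filter (· < k)).card *
        (1 : Matrix (Finset (Fin m)) (Finset (Fin m)) ℂ) (S.erase k) T else 0 := by
    intro k S T
    rw [← L', mul_one]
  constructor
  · intro j k
    ext S T
    rw [Matrix.add_apply, L, L, one, one, Matrix.zero_apply]
    rcases eq_or_ne j k with rfl | hjk
    · simp
    by_cases hj : j ∈ S <;> by_cases hk : k ∈ S <;> simp only [Finset.mem_insert, hj, hk, hjk,
      hjk.symm, not_true_eq_false, not_false_eq_true, if_true, if_false, or_false, or_true, mul_zero,
      add_zero]
    rw [si j k S hj, si k j S hk, Finset.insert_comm j k S]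
    rcases lt_or_gt_of_ne hjk with h | h
    · simp only [h, h.not_gt, if_true, if_false]
      ring
    · simp only [h, h.not_gt, if_true, if_false]
      ring
  · intro j k
    ext S T
    rw [Matrix.add_apply, L, L', one, one']
    rcases eq_or_ne j k with rfl | hjk
    · by_cases hj : j ∈ S
      · have h1 := si j j (S.erase j) (by simp)
        rw [Finset.insert_erase hj] at h1
        simp only [hj, not_true_eq_false, if_false, if_true, Finset.mem_erase, ne_eq, false_and,
          not_false_eq_true, zero_add, se j j S hj, lt_irrefl, one_mul]
        rw [← mul_assoc, sq, one_mul, Finset.insert_erase hj]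
      · simp only [hj, not_false_eq_true, if_true, if_false, Finset.mem_insert_self,
          si j j S hj, lt_irrefl, one_mul, add_zero]
        rw [← mul_assoc, sq, one_mul, Finset.erase_insert hj]
    · by_cases hj : j ∈ S <;> by_cases hk : k ∈ S <;> simp only [Finset.mem_insert,
        Finset.mem_erase, hj, hk, hjk, hjk.symm, not_true_eq_false, not_false_eq_true, if_true,
        if_false, or_false, or_true, mul_zero, add_zero, and_true, and_false, ne_eq,
        Matrix.zero_apply]
      rw [si j k S hj, se k j S hk, Finset.erase_insert_of_ne hjk]
      rcases lt_or_gt_of_ne hjk with h | h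
      · simp only [h, h.not_gt, if_true, if_false]
        ring
      · simp only [h, h.not_gt, if_true, if_false]
        ring

/-- The `2m` Majorana operators, indexed by `(k, 0)` and `(k, 1)` for `k = 1, …, m`:
`c_{2k-1} = aₖ + aₖ†` is `majorana a (k, 0)` and `c_{2k} = -i (aₖ† - aₖ)` is
`majorana a (k, 1)`. -/
noncomputable def majorana {m : ℕ} {n : Type*} (a : Fin m → Matrix n n ℂ)
    (i : Fin m × Fin 2) : Matrix n n ℂ :=
  if i.2 = 0 then a i.1 + (a i.1)ᴴ else (-Complex.I) • ((a i.1)ᴴ - a i.1)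

/-- The rotated operators `∑ⱼ Rᵢⱼ cⱼ`. -/
noncomputable def rotated {ι n : Type*} [Fintype ι] (R : Matrix ι ι ℝ)
    (c : ι → Matrix n n ℂ) (i : ι) : Matrix n n ℂ :=
  ∑ j, (R i j : ℂ) • c j

/-- `Λ = ∑ᵢ cᵢ ⊗ cᵢ`. -/
noncomputable def lambdaOp {ι n : Type*} [Fintype ι] (c : ι → Matrix n n ℂ) :
    Matrix (n × n) (n × n) ℂ :=
  ∑ i, c i ⊗ₖ c i

/-- The null space of `Λ`, inside the two-copy Hilbert space. -/
noncomputable def lambdaNullSpace {ι n : Type*} [Fintype ι] [Fintype n] [DecidableEq n]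
    (c : ι → Matrix n n ℂ) : Submodule ℂ (EuclideanSpace ℂ (n × n)) :=
  LinearMap.ker (Matrix.toEuclideanLin (lambdaOp c))

/-- The product vector `|x, y⟩ = |x⟩ ⊗ |y⟩`. -/
noncomputable def tensorVec {n : Type*} (x y : EuclideanSpace ℂ n) :
    EuclideanSpace ℂ (n × n) :=
  WithLp.toLp 2 fun p => x p.1 * y p.2

/-- The operator `|x⟩⟨x|`. -/
noncomputable def ketBra {n : Type*} (x : EuclideanSpace ℂ n) : Matrix n n ℂ :=
  Matrix.vecMulVec x.ofLp (star x.ofLp)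

/-- The swap operator `|x, y⟩ ↦ |y, x⟩`. -/
noncomputable def swapOp (n : Type*) [Fintype n] :
    EuclideanSpace ℂ (n × n) →ₗ[ℂ] EuclideanSpace ℂ (n × n) :=
  (LinearIsometryEquiv.piLpCongrLeft 2 ℂ ℂ (Equiv.prodComm n n)).toLinearEquiv.toLinearMap

/-- The symmetric subspace: the vectors fixed by the swap operator. -/
noncomputable def symmetricSubspace (n : Type*) [Fintype n] :
    Submodule ℂ (EuclideanSpace ℂ (n × n)) :=
  LinearMap.eqLocus (swapOp n) LinearMap.id

/-- A Gaussian state in standard form: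
`ρ = 2⁻ᵐ ∏ₖ (I + i λₖ c̃_{2k-1} c̃_{2k})`, with `c̃` obtained from the Majorana operators by a rotation
in `SO(2m)` and `λₖ ∈ [-1, 1]`. (The factors commute with each other.) -/
def IsGaussianState {m : ℕ} {n : Type*} [Fintype n] [DecidableEq n]
    (a : Fin m → Matrix n n ℂ) (ρ : Matrix n n ℂ) : Prop :=
  ∃ R ∈ Matrix.specialOrthogonalGroup (Fin m × Fin 2) ℝ, ∃ l : Fin m → ℝ,
    (∀ k, l k ∈ Set.Icc (-1 : ℝ) 1) ∧
    ρ = ((2 : ℂ) ^ m)⁻¹ • (List.ofFn fun k : Fin m =>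
      (1 : Matrix n n ℂ) + (Complex.I * (l k : ℂ)) •
        (rotated R (majorana a) (k, 0) * rotated R (majorana a) (k, 1))).prod

/-- A unit vector `ψ` is pure Gaussian if `|ψ⟩⟨ψ|` is a Gaussian state. -/
def IsPureGaussian {m : ℕ} {n : Type*} [Fintype n] [DecidableEq n]
    (a : Fin m → Matrix n n ℂ) (ψ : EuclideanSpace ℂ n) : Prop :=
  ‖ψ‖ = 1 ∧ IsGaussianState a (ketBra ψ)

/-- The annihilation operators `ãₖ = (c̃_{2k-1} - i c̃_{2k}) / 2` belonging to the rotated Majorana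
operators `c̃ᵢ = ∑ⱼ Rᵢⱼ cⱼ`. For `R = 1` these are the original `aₖ`. -/
noncomputable def rotatedAnnihilation {m : ℕ} {n : Type*}
    (a : Fin m → Matrix n n ℂ) (R : Matrix (Fin m × Fin 2) (Fin m × Fin 2) ℝ) (k : Fin m) :
    Matrix n n ℂ :=
  (2 : ℂ)⁻¹ • (rotated R (majorana a) (k, 0) - Complex.I • rotated R (majorana a) (k, 1))

/-- `v` is a (normalized, Gaussian) vacuum vector with respect to some set of annihilation
operators, obtained from the Majorana operators by a rotation in `O(2m)`. -/
def IsGaussianVacuum {m : ℕ} {n : Type*} [Fintype n] (a : Fin m → Matrix n n ℂ)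
    (v : EuclideanSpace ℂ n) : Prop :=
  ‖v‖ = 1 ∧ ∃ R ∈ Matrix.orthogonalGroup (Fin m × Fin 2) ℝ,
    ∀ k, rotatedAnnihilation a R k *ᵥ v.ofLp = 0

/-- The unitary `U` induces the orthogonal matrix `R`: `U cᵢ U† = ∑ⱼ Rᵢⱼ cⱼ`. -/
def Induces {ι n : Type*} [Fintype ι] [Fintype n] [DecidableEq n] (c : ι → Matrix n n ℂ)
    (U : Matrix.unitaryGroup n ℂ) (R : Matrix ι ι ℝ) : Prop :=
  ∀ i, (U : Matrix n n ℂ) * c i * (U : Matrix n n ℂ)ᴴ = rotated R c i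

/-- The orthogonal group is compact. -/
instance orthogonalGroup_compactSpace (ι : Type*) [Fintype ι] [DecidableEq ι] :
    CompactSpace (Matrix.orthogonalGroup ι ℝ) := by
  refine (isCompact_iff_compactSpace (s := (Matrix.orthogonalGroup ι ℝ : Set (Matrix ι ι ℝ)))).mp ?_
  have hK : IsCompact (Set.univ.pi fun _ : ι => Set.univ.pi fun _ : ι => Metric.closedBall (0 : ℝ) 1) :=
    isCompact_univ_pi fun _ => isCompact_univ_pi fun _ => isCompact_closedBall 0 1
  refine IsCompact.of_isClosed_subset (X := Matrix ι ι ℝ) hK ?_ ?_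
  · have : (Matrix.orthogonalGroup ι ℝ : Set (Matrix ι ι ℝ)) = {A | A * Aᵀ = 1} := by
      ext A
      exact Matrix.mem_orthogonalGroup_iff ι ℝ
    rw [this]
    exact isClosed_eq (by fun_prop) continuous_const
  · intro A hA i _ j _
    simpa using entry_norm_bound_of_unitary (𝕜 := ℝ) hA i j

instance orthogonalGroup_measurableSpace (ι : Type*) [Fintype ι] [DecidableEq ι] :
    MeasurableSpace (Matrix.orthogonalGroup ι ℝ) := borel _

instance orthogonalGroup_borelSpace (ι : Type*) [Fintype ι] [DecidableEq ι] :
    BorelSpace (Matrix.orthogonalGroup ι ℝ) := ⟨rfl⟩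

/-- The Haar measure of the orthogonal group, normalized to total mass `1`. -/
noncomputable def orthogonalHaar (ι : Type*) [Fintype ι] [DecidableEq ι] :
    MeasureTheory.Measure (Matrix.orthogonalGroup ι ℝ) :=
  MeasureTheory.Measure.haarMeasure ⊤

/-- The integrand `(U_R ⊗ U_R) X (U_R† ⊗ U_R†)` of the twirl. -/
noncomputable def twirlIntegrand {ι n : Type*} [Fintype ι] [DecidableEq ι] [Fintype n]
    [DecidableEq n] (U : Matrix.orthogonalGroup ι ℝ → Matrix.unitaryGroup n ℂ)
    (X : Matrix (n × n) (n × n) ℂ) (R : Matrix.orthogonalGroup ι ℝ) :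
    Matrix (n × n) (n × n) ℂ :=
  ((U R : Matrix n n ℂ) ⊗ₖ (U R : Matrix n n ℂ)) * X *
    ((U R : Matrix n n ℂ)ᴴ ⊗ₖ (U R : Matrix n n ℂ)ᴴ)

/-- The FLO twirl `𝒮(X) = ∫ dR (U_R ⊗ U_R) X (U_R† ⊗ U_R†)` over the normalized Haar measure of the
orthogonal group, for a choice `R ↦ U_R` of unitaries; the integral is taken entrywise. -/
noncomputable def floTwirl {ι n : Type*} [Fintype ι] [DecidableEq ι] [Fintype n]
    [DecidableEq n] (U : Matrix.orthogonalGroup ι ℝ → Matrix.unitaryGroup n ℂ)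
    (X : Matrix (n × n) (n × n) ℂ) : Matrix (n × n) (n × n) ℂ :=
  Matrix.of fun p q => ∫ R, twirlIntegrand U X R p q ∂(orthogonalHaar ι)

/-! The operators `c i ⊗ₖ c i` are 2m commuting Hermitian involutions on a space of dimension
2^(2m), and the sign of each can be flipped without disturbing the others. So every sign pattern,
recorded as the set A of its plus signs, has a one-dimensional joint eigenspace, and these lines
give an orthonormal basis (`IsQubitFamily.exists_orthonormalBasis`). On the vector of A the operator
Λ has eigenvalue 2|A| - 2m, so its null space is spanned by the binom(2m, m) patterns with |A| = m.

The twirled operator commutes with every U_R ⊗ U_R. Taking for U_R the c_j themselves makes it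
diagonal in this basis; taking permutations of the c_j makes its eigenvalues depend on |A| only
(`exists_eigenvalue_of_invariant`). Since Λ is rotation invariant and kills |0,0⟩, it kills the
twirl of |0,0⟩⟨0,0|, which is therefore a multiple of the projector; trace one fixes the factor.

The range of this twirl lies in the span of the vectors U_R v ⊗ U_R v, which are doubled pure
Gaussian vectors. Conversely a pure Gaussian ψ is a joint eigenvector of rotated mode parities,
which forces Λ(ψ ⊗ ψ) = 0. Symmetry of the null space follows from the spanning set.

The same eigenbasis argument for the maps X ↦ d_i X c_i on matrices yields Schur's lemma, the
equivalence of Clifford representations, and the fact that the c_i generate all matrices. The last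
makes the twirl integrand continuous in R, whatever phases the U_R carry. -/

/-- A matrix as a continuous linear operator on Euclidean space. -/
noncomputable def euclOp {n : Type*} [Fintype n] [DecidableEq n] (M : Matrix n n ℂ) :
    EuclideanSpace ℂ n →L[ℂ] EuclideanSpace ℂ n :=
  Matrix.toEuclideanCLM (n := n) (𝕜 := ℂ) M

/-! ### Matrices acting on Euclidean space -/

section EuclOp

variable {n : Type*} [Fintype n] [DecidableEq n] (M M' : Matrix n n ℂ) (v w : EuclideanSpace ℂ n)

theorem euclOp_mul : euclOp (M * M') v = euclOp M (euclOp M' v) := by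
  simp [euclOp]

theorem euclOp_one : euclOp (1 : Matrix n n ℂ) v = v := by
  simp [euclOp]

theorem euclOp_zero : euclOp (0 : Matrix n n ℂ) v = 0 := by
  simp [euclOp]

theorem euclOp_add : euclOp (M + M') v = euclOp M v + euclOp M' v := by
  simp [euclOp]

theorem euclOp_sub : euclOp (M - M') v = euclOp M v - euclOp M' v := by
  simp [euclOp]

theorem euclOp_neg : euclOp (-M) v = -euclOp M v := by
  simp [euclOp]

theorem euclOp_smul (r : ℂ) : euclOp (r • M) v = r • euclOp M v := by
  simp [euclOp]

theorem euclOp_sum {κ : Type*} (s : Finset κ) (f : κ → Matrix n n ℂ) :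
    euclOp (∑ k ∈ s, f k) v = ∑ k ∈ s, euclOp (f k) v := by
  simp [euclOp]

theorem euclOp_toLp (x : n → ℂ) : euclOp M (WithLp.toLp 2 x) = WithLp.toLp 2 (M *ᵥ x) :=
  Matrix.toEuclideanCLM_toLp M x

theorem ofLp_euclOp : (euclOp M v).ofLp = M *ᵥ v.ofLp :=
  Matrix.ofLp_toEuclideanCLM M v

theorem euclOp_injective : Function.Injective (euclOp (n := n)) :=
  (Matrix.toEuclideanCLM (n := n) (𝕜 := ℂ)).injective

theorem inner_euclOp_left : inner ℂ (euclOp M v) w = inner ℂ v (euclOp Mᴴ w) := by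
  have : euclOp Mᴴ = (euclOp M).adjoint := by
    rw [← ContinuousLinearMap.star_eq_adjoint]
    exact map_star (Matrix.toEuclideanCLM (n := n) (𝕜 := ℂ)) M
  rw [this, ContinuousLinearMap.adjoint_inner_right]

variable {M} in
theorem euclOp_ne_zero_of_isUnit (hM : IsUnit M) {v : EuclideanSpace ℂ n} (hv : v ≠ 0) :
    euclOp M v ≠ 0 := by
  obtain ⟨u, rfl⟩ := hM
  intro h
  apply hv
  rw [← euclOp_one v, ← u.inv_mul, euclOp_mul, h, map_zero]

theorem ext_euclOp_basis {κ : Type*} [Fintype κ] (b : OrthonormalBasis κ ℂ (EuclideanSpace ℂ n))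
    {M M' : Matrix n n ℂ} (h : ∀ k, euclOp M (b k) = euclOp M' (b k)) : M = M' := by
  apply euclOp_injective
  ext1 x
  rw [← b.sum_repr' x, map_sum, map_sum]
  simp only [map_smul, h]

end EuclOp

/-! ### Joint eigenbases of commuting involutions -/

/-- The sign pattern that is `1` on `A` and `-1` outside. -/
noncomputable def memSign {ι : Type*} [DecidableEq ι] (A : Finset ι) (i : ι) : ℂ :=
  if i ∈ A then 1 else -1

section MemSign

variable {ι : Type*} [DecidableEq ι]

theorem memSign_mul_self (A : Finset ι) (i : ι) : memSign A i * memSign A i = 1 := by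
  unfold memSign; split_ifs <;> simp

theorem star_memSign (A : Finset ι) (i : ι) : star (memSign A i) = memSign A i := by
  unfold memSign; split_ifs <;> simp

theorem exists_memSign_ne {A B : Finset ι} (h : A ≠ B) : ∃ i, memSign A i ≠ memSign B i := by
  by_contra! hc
  apply h
  ext i
  have := hc i
  unfold memSign at this
  split_ifs at this with h1 h2 h2
  · simp [h1, h2]
  · norm_num at this
  · norm_num at this
  · simp [h1, h2]

end MemSign

/-- A family of commuting Hermitian involutions, each of which can be flipped on its own, on a
space whose dimension is `2` to the size of the family. -/
structure IsQubitFamily {ι N : Type*} [Fintype ι] [Fintype N] [DecidableEq N]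
    (T : ι → Matrix N N ℂ) : Prop where
  card_eq : Fintype.card N = 2 ^ Fintype.card ι
  isHermitian : ∀ i, (T i)ᴴ = T i
  mul_self : ∀ i, T i * T i = 1
  commute : ∀ i j, T i * T j = T j * T i
  exists_flip : ∀ j, ∃ D : Matrix N N ℂ, IsUnit D ∧ T j * D = -(D * T j) ∧
    ∀ i, i ≠ j → T i * D = D * T i

namespace IsQubitFamily

variable {ι N : Type*} [Fintype ι] [DecidableEq ι] [Fintype N] [DecidableEq N]
  {T : ι → Matrix N N ℂ}

/-- Induction on s. Adding ± T_j v to v projects onto the wanted eigenspace of T_j. If the result is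
zero, v already has the opposite sign, and the flip D corrects it while leaving the earlier signs
alone. -/
theorem exists_joint_eigenvector (hT : IsQubitFamily T) (A s : Finset ι) :
    ∃ v : EuclideanSpace ℂ N, v ≠ 0 ∧ ∀ i ∈ s, euclOp (T i) v = memSign A i • v := by
  induction s using Finset.induction_on with
  | empty =>
    have : Nonempty N := by
      rw [← Fintype.card_pos_iff, hT.card_eq]
      positivity
    obtain ⟨v, hv⟩ := exists_ne (0 : EuclideanSpace ℂ N)
    exact ⟨v, hv, by simp⟩
  | insert j s hj ih =>
    obtain ⟨v, hv, hvs⟩ := ih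
    by_cases h0 : v + memSign A j • euclOp (T j) v = 0
    · obtain ⟨D, hD, hDj, hDi⟩ := hT.exists_flip j
      refine ⟨euclOp D v, euclOp_ne_zero_of_isUnit hD hv, fun i hi => ?_⟩
      rcases Finset.mem_insert.mp hi with rfl | his
      · have hTv : euclOp (T i) v = -memSign A i • v := by
          have := congrArg (memSign A i • ·) h0
          simp only [smul_add, smul_smul, memSign_mul_self, one_smul, smul_zero] at this
          rw [neg_smul, eq_neg_iff_add_eq_zero, add_comm, this]
        rw [← euclOp_mul, hDj, euclOp_neg, euclOp_mul, hTv, map_smul, neg_smul, neg_neg]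
      · rw [← euclOp_mul, hDi i (by rintro rfl; exact hj his), euclOp_mul, hvs i his, map_smul]
    · refine ⟨_, h0, fun i hi => ?_⟩
      rcases Finset.mem_insert.mp hi with rfl | hi
      · rw [map_add, map_smul, ← euclOp_mul, hT.mul_self, euclOp_one, smul_add, smul_smul,
          memSign_mul_self, one_smul, add_comm]
      · rw [map_add, map_smul, ← euclOp_mul, hT.commute, euclOp_mul, hvs i hi, map_smul,
          smul_add, smul_comm]

theorem inner_eq_zero (hT : IsQubitFamily T) {A B : Finset ι} (hAB : A ≠ B)
    {v w : EuclideanSpace ℂ N} (hv : ∀ i, euclOp (T i) v = memSign A i • v)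
    (hw : ∀ i, euclOp (T i) w = memSign B i • w) : inner ℂ v w = 0 := by
  obtain ⟨i, hi⟩ := exists_memSign_ne hAB
  have h := inner_euclOp_left (T i) v w
  rw [hT.isHermitian, hv, hw, inner_smul_left, inner_smul_right] at h
  have h' : (memSign A i - memSign B i) * inner ℂ v w = 0 := by
    rw [sub_mul, sub_eq_zero]
    simpa [starRingEnd_apply, star_memSign] using h
  exact (mul_eq_zero.mp h').resolve_left (sub_ne_zero.mpr hi)

/-- Distinct patterns give orthogonal vectors, and there are as many patterns as dimensions. -/
theorem exists_orthonormalBasis (hT : IsQubitFamily T) :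
    ∃ b : OrthonormalBasis (Finset ι) ℂ (EuclideanSpace ℂ N),
      ∀ A i, euclOp (T i) (b A) = memSign A i • b A := by
  choose v hv0 hv using fun A => hT.exists_joint_eigenvector A Finset.univ
  let u : Finset ι → EuclideanSpace ℂ N := fun A => ((‖v A‖ : ℂ)⁻¹) • v A
  have hu : ∀ A i, euclOp (T i) (u A) = memSign A i • u A := by
    intro A i
    simp only [u]
    rw [map_smul, hv A i (Finset.mem_univ i), smul_comm]
  have hon : Orthonormal ℂ u := by
    refine ⟨fun A => ?_, fun A B hAB => hT.inner_eq_zero hAB (hu A) (hu B)⟩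
    simp [u, norm_smul, hv0 A]
  have hcard : Fintype.card (Finset ι) = Module.finrank ℂ (EuclideanSpace ℂ N) := by
    rw [finrank_euclideanSpace, hT.card_eq, Fintype.card_finset]
  refine ⟨OrthonormalBasis.mk hon ?_, fun A i => ?_⟩
  · exact (hon.linearIndependent.span_eq_top_of_card_eq_finrank' hcard).ge
  · simpa using hu A i

theorem eq_smul_of_joint_eigenvector (hT : IsQubitFamily T)
    {b : OrthonormalBasis (Finset ι) ℂ (EuclideanSpace ℂ N)}
    (hb : ∀ A i, euclOp (T i) (b A) = memSign A i • b A) {A : Finset ι}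
    {v : EuclideanSpace ℂ N} (hv : ∀ i, euclOp (T i) v = memSign A i • v) :
    v = inner ℂ (b A) v • b A := by
  conv_lhs => rw [← b.sum_repr' v]
  refine Finset.sum_eq_single A (fun B _ hBA => ?_) (by simp)
  rw [hT.inner_eq_zero hBA (hb B) hv, zero_smul]

/-- Joint eigenspaces are one-dimensional. -/
theorem exists_smul_of_joint_eigenvector (hT : IsQubitFamily T) {A : Finset ι}
    {v w : EuclideanSpace ℂ N} (hw0 : w ≠ 0) (hv : ∀ i, euclOp (T i) v = memSign A i • v)
    (hw : ∀ i, euclOp (T i) w = memSign A i • w) : ∃ r : ℂ, v = r • w := by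
  obtain ⟨b, hb⟩ := hT.exists_orthonormalBasis
  have h1 := hT.eq_smul_of_joint_eigenvector hb hv
  have h2 := hT.eq_smul_of_joint_eigenvector hb hw
  have hc : inner ℂ (b A) w ≠ 0 := by
    intro h
    rw [h, zero_smul] at h2
    exact hw0 h2
  refine ⟨inner ℂ (b A) v * (inner ℂ (b A) w)⁻¹, ?_⟩
  refine h1.trans ?_
  rw [mul_smul, ← (eq_inv_smul_iff₀ hc).mpr h2.symm]

end IsQubitFamily

/-! ### Clifford families and their sign flips -/

/-- Hermitian generators of a Clifford algebra. -/
structure IsCliffordFamily {ι n : Type*} [DecidableEq ι] [Fintype n] [DecidableEq n]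
    (c : ι → Matrix n n ℂ) : Prop where
  isHermitian : ∀ i, (c i)ᴴ = c i
  anticomm : ∀ i j, c i * c j + c j * c i = if i = j then 2 else 0

namespace IsCliffordFamily

variable {ι n : Type*} [DecidableEq ι] [Fintype n] [DecidableEq n]
  {c d : ι → Matrix n n ℂ}

theorem mul_self (hc : IsCliffordFamily c) (i : ι) : c i * c i = 1 := by
  have h := hc.anticomm i i
  rw [if_pos rfl, ← two_smul ℂ (c i * c i)] at h
  have h2 : (2 : Matrix n n ℂ) = (2 : ℂ) • 1 := by
    rw [← Algebra.algebraMap_eq_smul_one, map_ofNat]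
  rw [h2] at h
  exact smul_right_injective _ (two_ne_zero' ℂ) h

theorem mul_comm_neg (hc : IsCliffordFamily c) {i j : ι} (h : i ≠ j) :
    c i * c j = -(c j * c i) := by
  have := hc.anticomm i j
  rw [if_neg h] at this
  exact eq_neg_of_add_eq_zero_left this

theorem isUnit (hc : IsCliffordFamily c) (i : ι) : IsUnit (c i) :=
  ⟨⟨c i, c i, hc.mul_self i, hc.mul_self i⟩, rfl⟩

theorem mem_unitaryGroup (hc : IsCliffordFamily c) (i : ι) :
    c i ∈ Matrix.unitaryGroup n ℂ := by
  rw [Matrix.mem_unitaryGroup_iff, Matrix.star_eq_conjTranspose, hc.isHermitian, hc.mul_self]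

/-- Needed because Z ↦ Y Z X becomes Xᵀ ⊗ Y after vectorization. -/
theorem transpose (hc : IsCliffordFamily c) : IsCliffordFamily fun i => (c i)ᵀ where
  isHermitian i := by
    change ((c i)ᴴ)ᵀ = _
    rw [hc.isHermitian]
  anticomm i j := by
    rw [← Matrix.transpose_mul, ← Matrix.transpose_mul, ← Matrix.transpose_add, add_comm,
      hc.anticomm]
    split_ifs <;> simp

/-- Each factor other than c_i costs a sign. The exponent length + count has the parity of length -
count and avoids subtraction. -/
theorem mul_list_prod (hc : IsCliffordFamily c) (i : ι) (l : List ι) :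
    c i * (l.map c).prod = (-1 : ℂ) ^ (l.length + l.count i) • ((l.map c).prod * c i) := by
  induction l with
  | nil => simp
  | cons j l ih =>
    rw [List.map_cons, List.prod_cons, ← mul_assoc]
    by_cases h : j = i
    · subst h
      rw [mul_assoc, ih, List.length_cons, List.count_cons_self, Algebra.mul_smul_comm,
        ← mul_assoc, ih]
      congr 1
      ring
    · rw [hc.mul_comm_neg (Ne.symm h), neg_mul, mul_assoc, ih, List.length_cons,
        List.count_cons_of_ne h, Algebra.mul_smul_comm, mul_assoc, ← neg_smul]
      congr 1
      ring

/-- In an even Clifford algebra, a single generator can be flipped. -/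
theorem exists_flip [Fintype ι] (hc : IsCliffordFamily c) (hι : Even (Fintype.card ι)) (j : ι) :
    ∃ D ∈ Algebra.adjoin ℂ (Set.range c), IsUnit D ∧ c j * D = -(D * c j) ∧
      ∀ i, i ≠ j → c i * D = D * c i := by
  have hmem : ∀ i, c i ∈ Algebra.adjoin ℂ (Set.range c) := fun i =>
    Algebra.subset_adjoin (Set.mem_range_self i)
  -- G is the product of all generators. Their number is even, so c_i meets an odd number of other
  -- factors and anticommutes with G.
  set G := ((Finset.univ : Finset ι).toList.map c).prod with hG
  have hanti : ∀ i, c i * G = -(G * c i) := by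
    intro i
    rw [hG, hc.mul_list_prod, Finset.length_toList, Finset.card_univ,
      List.count_eq_one_of_mem (Finset.nodup_toList _) (by simp), pow_succ, hι.neg_one_pow]
    simp
  have hGmem : G ∈ Algebra.adjoin ℂ (Set.range c) := by
    apply list_prod_mem
    intro x hx
    obtain ⟨i, -, rfl⟩ := List.mem_map.mp hx
    exact hmem i
  have hGu : IsUnit G := by
    apply List.prod_isUnit
    intro x hx
    obtain ⟨i, -, rfl⟩ := List.mem_map.mp hx
    exact hc.isUnit i
  -- c_j anticommutes with every other generator and commutes with itself; the extra factor G
  -- reverses both behaviours.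
  refine ⟨c j * G, mul_mem (hmem j) hGmem, (hc.isUnit j).mul hGu, ?_, fun i hi => ?_⟩
  · rw [mul_assoc, ← mul_neg, ← hanti]
  · rw [← mul_assoc, hc.mul_comm_neg hi, neg_mul, mul_assoc, mul_assoc, hanti, mul_neg, neg_neg]

/-- The two anticommutation signs cancel in the tensor product, so the products commute. A flip
acting on the first factor alone flips a single product. -/
theorem isQubitFamily_kronecker [Fintype ι] (hc : IsCliffordFamily c) (hd : IsCliffordFamily d)
    (hι : Even (Fintype.card ι)) (hn : Fintype.card n ^ 2 = 2 ^ Fintype.card ι) :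
    IsQubitFamily fun i => c i ⊗ₖ d i where
  card_eq := by rw [Fintype.card_prod, ← sq, hn]
  isHermitian i := by rw [Matrix.conjTranspose_kronecker, hc.isHermitian, hd.isHermitian]
  mul_self i := by
    rw [← Matrix.mul_kronecker_mul, hc.mul_self, hd.mul_self, Matrix.one_kronecker_one]
  commute i j := by
    rw [← Matrix.mul_kronecker_mul, ← Matrix.mul_kronecker_mul]
    by_cases h : i = j
    · rw [h]
    · rw [hc.mul_comm_neg h, hd.mul_comm_neg h]
      ext
      simp
  exists_flip j := by
    obtain ⟨D, -, hDu, hDj, hDi⟩ := hc.exists_flip hι j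
    refine ⟨D ⊗ₖ 1, ?_, ?_, fun i hi => ?_⟩
    · obtain ⟨u, rfl⟩ := hDu
      refine ⟨⟨(u : Matrix n n ℂ) ⊗ₖ 1, ((u⁻¹ : (Matrix n n ℂ)ˣ) : Matrix n n ℂ) ⊗ₖ 1,
        ?_, ?_⟩, rfl⟩
      · rw [← Matrix.mul_kronecker_mul, u.mul_inv, mul_one, Matrix.one_kronecker_one]
      · rw [← Matrix.mul_kronecker_mul, u.inv_mul, mul_one, Matrix.one_kronecker_one]
    · rw [← Matrix.mul_kronecker_mul, ← Matrix.mul_kronecker_mul, hDj, mul_one, one_mul]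
      ext
      simp
    · rw [← Matrix.mul_kronecker_mul, ← Matrix.mul_kronecker_mul, hDi i hi, mul_one, one_mul]

end IsCliffordFamily

/-! ### Irreducibility, equivalence and generation for Clifford representations -/

namespace IsCliffordFamily

section Intertwiners

variable {ι n : Type*} [Fintype ι] [DecidableEq ι] [Fintype n] [DecidableEq n]
  {c d : ι → Matrix n n ℂ}

theorem euclOp_transpose_kronecker_vec (X Y Z : Matrix n n ℂ) :
    euclOp (Xᵀ ⊗ₖ Y) (WithLp.toLp 2 Z.vec) = WithLp.toLp 2 (Y * Z * X).vec := by
  rw [euclOp_toLp, Matrix.kronecker_mulVec_vec, Matrix.transpose_transpose]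

omit [Fintype n] [DecidableEq n] in
theorem exists_toLp_vec (v : EuclideanSpace ℂ (n × n)) :
    ∃ X : Matrix n n ℂ, v = WithLp.toLp 2 X.vec := by
  obtain ⟨X, hX⟩ := Matrix.vec_bijective.surjective v.ofLp
  exact ⟨X, by rw [hX]⟩

omit [Fintype n] [DecidableEq n] in
theorem toLp_vec_ne_zero {X : Matrix n n ℂ} (hX : X ≠ 0) :
    (WithLp.toLp 2 X.vec : EuclideanSpace ℂ (n × n)) ≠ 0 := by
  intro h
  exact hX (Matrix.vec_eq_zero_iff.mp (by simpa using congrArg WithLp.ofLp h))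

omit [DecidableEq ι] [DecidableEq n] in
theorem nonempty_of_card (hn : Fintype.card n ^ 2 = 2 ^ Fintype.card ι) : Nonempty n := by
  rw [← Fintype.card_pos_iff, Nat.pos_iff_ne_zero]
  intro h
  rw [h] at hn
  have : 0 < 2 ^ Fintype.card ι := by positivity
  omega

variable (hc : IsCliffordFamily c)
  (hι : Even (Fintype.card ι)) (hn : Fintype.card n ^ 2 = 2 ^ Fintype.card ι)
include hc hι hn

/-- Vectorized, such an X is a joint eigenvector of the operators c_iᵀ ⊗ d_i. -/
theorem exists_eigenmatrix (hd : IsCliffordFamily d) (A : Finset ι) :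
    ∃ X : Matrix n n ℂ, X ≠ 0 ∧ ∀ i, d i * X * c i = memSign A i • X := by
  obtain ⟨v, hv0, hv⟩ := (hc.transpose.isQubitFamily_kronecker hd hι hn).exists_joint_eigenvector
    A Finset.univ
  obtain ⟨X, rfl⟩ := exists_toLp_vec v
  refine ⟨X, ?_, fun i => ?_⟩
  · rintro rfl
    simp at hv0
  · have := hv i (Finset.mem_univ i)
    rw [euclOp_transpose_kronecker_vec, ← WithLp.toLp_smul, ← Matrix.vec_smul] at this
    exact Matrix.vec_inj.mp (WithLp.toLp_injective 2 this)

theorem exists_smul_of_eigenmatrix (hd : IsCliffordFamily d) {A : Finset ι} {X Y : Matrix n n ℂ}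
    (hY0 : Y ≠ 0) (hX : ∀ i, d i * X * c i = memSign A i • X)
    (hY : ∀ i, d i * Y * c i = memSign A i • Y) : ∃ r : ℂ, X = r • Y := by
  have key : ∀ Z : Matrix n n ℂ, (∀ i, d i * Z * c i = memSign A i • Z) → ∀ i,
      euclOp ((c i)ᵀ ⊗ₖ d i) (WithLp.toLp 2 Z.vec) = memSign A i • WithLp.toLp 2 Z.vec := by
    intro Z hZ i
    rw [euclOp_transpose_kronecker_vec, hZ, Matrix.vec_smul, WithLp.toLp_smul]
  obtain ⟨r, hr⟩ := (hc.transpose.isQubitFamily_kronecker hd hι hn).exists_smul_of_joint_eigenvector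
    (toLp_vec_ne_zero hY0) (key X hX) (key Y hY)
  rw [← WithLp.toLp_smul, ← Matrix.vec_smul] at hr
  exact ⟨r, Matrix.vec_inj.mp (WithLp.toLp_injective 2 hr)⟩

/-- Schur's lemma: the Clifford representation on `ℂ^(2^m)` is irreducible. -/
theorem eq_smul_one_of_commute {M : Matrix n n ℂ} (hM : ∀ i, c i * M = M * c i) :
    ∃ r : ℂ, M = r • (1 : Matrix n n ℂ) := by
  have := nonempty_of_card hn
  -- Both M and 1 are eigenmatrices for the all-plus pattern, whose eigenspace is a line.
  refine hc.exists_smul_of_eigenmatrix hι hn hc (A := Finset.univ) one_ne_zero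
    (fun i => ?_) (fun i => ?_)
  · rw [hM, mul_assoc, hc.mul_self, mul_one]
    simp [memSign]
  · rw [mul_one, hc.mul_self]
    simp [memSign]

open scoped ComplexOrder in
/-- Any two Clifford representations on `ℂ^(2^m)` are unitarily equivalent. -/
theorem exists_unitary_intertwiner (hd : IsCliffordFamily d) :
    ∃ U : Matrix.unitaryGroup n ℂ,
      ∀ i, (U : Matrix n n ℂ) * c i * (U : Matrix n n ℂ)ᴴ = d i := by
  obtain ⟨j⟩ := nonempty_of_card hn
  obtain ⟨X, hX0, hX⟩ := hc.exists_eigenmatrix hι hn hd Finset.univ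
  have hX1 : ∀ i, d i * X = X * c i := by
    intro i
    have := congrArg (· * c i) (hX i)
    simpa [memSign, mul_assoc, hc.mul_self] using this
  have hX2 : ∀ i, Xᴴ * d i = c i * Xᴴ := by
    intro i
    have := congrArg Matrix.conjTranspose (hX1 i)
    simpa [Matrix.conjTranspose_mul, hc.isHermitian, hd.isHermitian] using this
  -- X intertwines c and d, so XᴴX commutes with every c_i and is scalar; rescaling X then makes it
  -- unitary.
  obtain ⟨r, hr⟩ := hc.eq_smul_one_of_commute hι hn (M := Xᴴ * X) fun i => by
    rw [← mul_assoc, ← hX2, mul_assoc, hX1, mul_assoc]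
  -- The scalar is read off a diagonal entry of XᴴX: the squared norm of column j.
  set t : ℝ := ∑ k, ‖X k j‖ ^ 2 with ht
  have hrt : r = (t : ℂ) := by
    have := congrArg (fun M : Matrix n n ℂ => M j j) hr
    simp only [Matrix.mul_apply, Matrix.conjTranspose_apply, Matrix.smul_apply,
      Matrix.one_apply_eq, smul_eq_mul, mul_one] at this
    rw [← this, ht]
    push_cast
    refine Finset.sum_congr rfl fun k _ => ?_
    exact RCLike.conj_mul (X k j)
  have ht0 : 0 < t := by
    refine lt_of_le_of_ne (Finset.sum_nonneg fun k _ => by positivity) fun h => ?_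
    rw [hrt, ← h] at hr
    exact hX0 (Matrix.conjTranspose_mul_self_eq_zero.mp (by simpa using hr))
  set s : ℂ := (((Real.sqrt t)⁻¹ : ℝ) : ℂ) with hs
  have hss : s * s * r = 1 := by
    rw [hs, hrt, ← Complex.ofReal_mul, ← Complex.ofReal_mul, ← mul_inv,
      Real.mul_self_sqrt ht0.le, inv_mul_cancel₀ ht0.ne', Complex.ofReal_one]
  have hstar : star s = s := Complex.conj_ofReal _
  have hU : s • X ∈ Matrix.unitaryGroup n ℂ := by
    rw [Matrix.mem_unitaryGroup_iff', Matrix.star_eq_conjTranspose, Matrix.conjTranspose_smul,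
      hstar, Matrix.smul_mul, Matrix.mul_smul, hr, smul_smul, smul_smul, hss, one_smul]
  refine ⟨⟨s • X, hU⟩, fun i => ?_⟩
  have hU' : (s • X) * (s • X)ᴴ = 1 := Matrix.mem_unitaryGroup_iff.mp hU
  calc (s • X) * c i * (s • X)ᴴ = d i * ((s • X) * (s • X)ᴴ) := by
        rw [← mul_assoc, Matrix.mul_smul, hX1, Matrix.smul_mul]
    _ = d i := by rw [hU', mul_one]

omit hn in
-- A product of single flips over the complement of A. Unlike `exists_eigenmatrix`, this places the
-- eigenmatrix inside the generated algebra.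
theorem exists_isUnit_eigenmatrix (A : Finset ι) :
    ∃ M ∈ Algebra.adjoin ℂ (Set.range c), IsUnit M ∧ ∀ i, c i * M * c i = memSign A i • M := by
  have key : ∀ s : Finset ι, ∃ M ∈ Algebra.adjoin ℂ (Set.range c), IsUnit M ∧
      ∀ i, c i * M = (-memSign s i) • (M * c i) := by
    intro s
    induction s using Finset.induction_on with
    | empty => exact ⟨1, one_mem _, isUnit_one, by simp [memSign]⟩
    | insert j s hj ih =>
      obtain ⟨M, hM, hMu, hMc⟩ := ih
      obtain ⟨D, hD, hDu, hDj, hDi⟩ := hc.exists_flip hι j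
      refine ⟨D * M, mul_mem hD hM, hDu.mul hMu, fun i => ?_⟩
      rw [← mul_assoc]
      by_cases hij : i = j
      · subst hij
        rw [hDj, neg_mul, mul_assoc, hMc]
        simp [memSign, hj, mul_assoc]
      · rw [hDi i hij, mul_assoc, hMc]
        simp [memSign, hij, mul_assoc]
  obtain ⟨M, hM, hMu, hMc⟩ := key Aᶜ
  refine ⟨M, hM, hMu, fun i => ?_⟩
  rw [hMc, Matrix.smul_mul, mul_assoc, hc.mul_self, mul_one]
  congr 1
  by_cases h : i ∈ A <;> simp [memSign, h]

/-- Each joint eigenspace is a line containing a nonzero element of the algebra, so the algebra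
contains a basis of all matrices. -/
theorem adjoin_eq_top : Algebra.adjoin ℂ (Set.range c) = ⊤ := by
  have := nonempty_of_card hn
  rw [Algebra.eq_top_iff]
  intro X
  obtain ⟨b, hb⟩ := (hc.transpose.isQubitFamily_kronecker hc hι hn).exists_orthonormalBasis
  have key : ∀ A, ∃ Y ∈ Algebra.adjoin ℂ (Set.range c), b A = WithLp.toLp 2 Y.vec := by
    intro A
    obtain ⟨M, hM, hMu, hMc⟩ := hc.exists_isUnit_eigenmatrix hι A
    obtain ⟨r, hr⟩ :=
      (hc.transpose.isQubitFamily_kronecker hc hι hn).exists_smul_of_joint_eigenvector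
        (toLp_vec_ne_zero hMu.ne_zero) (hb A) (fun i => by
          rw [euclOp_transpose_kronecker_vec, hMc, Matrix.vec_smul, WithLp.toLp_smul])
    refine ⟨r • M, Subalgebra.smul_mem _ hM r, ?_⟩
    rw [hr, Matrix.vec_smul, WithLp.toLp_smul]
  choose Y hY hbY using key
  have hX : X = ∑ A, (inner ℂ (b A) (WithLp.toLp 2 X.vec) : ℂ) • Y A := by
    apply Matrix.vec_inj.mp
    apply WithLp.toLp_injective 2
    refine (b.sum_repr' (WithLp.toLp 2 X.vec)).symm.trans ?_
    simp only [Matrix.vec_sum, Matrix.vec_smul, WithLp.toLp_sum, WithLp.toLp_smul, ← hbY]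
  rw [hX]
  exact sum_mem fun A _ => Subalgebra.smul_mem _ (hY A) _

end Intertwiners

/-! ### Rotated generators -/

section Rotations

variable {ι n : Type*} [Fintype ι] [DecidableEq ι] [Fintype n] [DecidableEq n]
  {c : ι → Matrix n n ℂ}

theorem rotated_orthogonal (hc : IsCliffordFamily c) {R : Matrix ι ι ℝ}
    (hR : R ∈ Matrix.orthogonalGroup ι ℝ) : IsCliffordFamily (rotated R c) where
  isHermitian i := by
    simp [rotated, Matrix.conjTranspose_sum, Matrix.conjTranspose_smul, hc.isHermitian]
  anticomm i j := by
    have h1 : rotated R c i * rotated R c j + rotated R c j * rotated R c i =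
        ∑ k, ∑ l, ((R i k : ℂ) * (R j l : ℂ)) • (c k * c l + c l * c k) := by
      simp only [rotated, Finset.sum_mul_sum, smul_add, Finset.sum_add_distrib]
      congr 1
      · simp only [Matrix.smul_mul, Matrix.mul_smul, smul_smul, mul_comm]
      · rw [Finset.sum_comm]
        simp only [Matrix.smul_mul, Matrix.mul_smul, smul_smul]
    have h2 : ∑ k, R i k * R j k = if i = j then 1 else 0 := by
      have := congrArg (fun M : Matrix ι ι ℝ => M i j) ((Matrix.mem_orthogonalGroup_iff ι ℝ).mp hR)
      simpa [Matrix.mul_apply, Matrix.one_apply] using this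
    rw [h1]
    simp only [hc.anticomm, smul_ite, smul_zero, Finset.sum_ite_eq, Finset.mem_univ, if_true]
    rw [← Finset.sum_smul]
    have h3 : (∑ k, (R i k : ℂ) * (R j k : ℂ)) = if i = j then 1 else 0 := by
      simpa [apply_ite Complex.ofReal] using congrArg Complex.ofReal h2
    rw [h3]
    split_ifs <;> simp

theorem exists_induces (hc : IsCliffordFamily c) (hι : Even (Fintype.card ι))
    (hn : Fintype.card n ^ 2 = 2 ^ Fintype.card ι) (R : Matrix.orthogonalGroup ι ℝ) :
    ∃ U : Matrix.unitaryGroup n ℂ, Induces c U R :=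
  hc.exists_unitary_intertwiner hι hn (hc.rotated_orthogonal R.2)

omit [Fintype n] [DecidableEq n] in
-- Orthonormality of the columns of R collapses the double sum. This allows Λ to be computed in
-- whichever rotated modes suit a given state.
theorem _root_.lambdaOp_rotated (c : ι → Matrix n n ℂ) {R : Matrix ι ι ℝ}
    (hR : R ∈ Matrix.orthogonalGroup ι ℝ) : lambdaOp (rotated R c) = lambdaOp c := by
  have h2 : ∀ k l, ∑ i, (R i k : ℂ) * (R i l : ℂ) = if k = l then 1 else 0 := by
    intro k l
    have := congrArg (fun M : Matrix ι ι ℝ => M k l) ((Matrix.mem_orthogonalGroup_iff' ι ℝ).mp hR)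
    have h3 : ∑ i, R i k * R i l = if k = l then 1 else 0 := by
      simpa [Matrix.mul_apply, Matrix.one_apply] using this
    simpa [apply_ite Complex.ofReal] using congrArg Complex.ofReal h3
  ext p q
  simp only [lambdaOp, rotated, Matrix.sum_apply, Matrix.kroneckerMap_apply, Matrix.smul_apply,
    smul_eq_mul, Finset.sum_mul_sum]
  rw [Finset.sum_comm]
  refine Finset.sum_congr rfl fun k _ => ?_
  rw [Finset.sum_comm]
  calc ∑ l, ∑ i, (R i k : ℂ) * c k p.1 q.1 * ((R i l : ℂ) * c l p.2 q.2)
      = ∑ l, (∑ i, (R i k : ℂ) * (R i l : ℂ)) * (c k p.1 q.1 * c l p.2 q.2) := by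
        refine Finset.sum_congr rfl fun l _ => ?_
        rw [Finset.sum_mul]
        exact Finset.sum_congr rfl fun i _ => by ring
    _ = c k p.1 q.1 * c k p.2 q.2 := by simp [h2]

end Rotations

end IsCliffordFamily

/-! ### Majorana operators and mode parities -/

section Majorana

variable {m : ℕ} {n : Type*} [Fintype n] [DecidableEq n]

theorem IsFermionicModes.isCliffordFamily {a : Fin m → Matrix n n ℂ} (ha : IsFermionicModes a) :
    IsCliffordFamily (majorana a) where
  isHermitian i := by
    unfold majorana
    split_ifs
    · simp [add_comm]
    · simp [← smul_neg]
  anticomm i j := by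
    have h1 := ha.anticomm i.1 j.1
    have h2 : (a i.1)ᴴ * (a j.1)ᴴ + (a j.1)ᴴ * (a i.1)ᴴ = 0 := by
      have := congrArg Matrix.conjTranspose (ha.anticomm j.1 i.1)
      simpa [Matrix.conjTranspose_mul] using this
    have h3 := ha.anticomm_conjTranspose i.1 j.1
    have h4 := ha.anticomm_conjTranspose j.1 i.1
    obtain ⟨i, x⟩ := i
    obtain ⟨j, y⟩ := j
    simp only at h1 h2 h3 h4
    -- Each Majorana anticommutator is regrouped into the four brackets whose values the canonical
    -- relations prescribe.
    have e00 : (a i + (a i)ᴴ) * (a j + (a j)ᴴ) + (a j + (a j)ᴴ) * (a i + (a i)ᴴ) =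
        (a i * a j + a j * a i) + ((a i)ᴴ * (a j)ᴴ + (a j)ᴴ * (a i)ᴴ) +
          (a i * (a j)ᴴ + (a j)ᴴ * a i) + (a j * (a i)ᴴ + (a i)ᴴ * a j) := by noncomm_ring
    have e01 : (a i + (a i)ᴴ) * ((a j)ᴴ - a j) + ((a j)ᴴ - a j) * (a i + (a i)ᴴ) =
        -(a i * a j + a j * a i) + ((a i)ᴴ * (a j)ᴴ + (a j)ᴴ * (a i)ᴴ) +
          (a i * (a j)ᴴ + (a j)ᴴ * a i) - (a j * (a i)ᴴ + (a i)ᴴ * a j) := by noncomm_ring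
    have e10 : ((a i)ᴴ - a i) * (a j + (a j)ᴴ) + (a j + (a j)ᴴ) * ((a i)ᴴ - a i) =
        -(a i * a j + a j * a i) + ((a i)ᴴ * (a j)ᴴ + (a j)ᴴ * (a i)ᴴ) -
          (a i * (a j)ᴴ + (a j)ᴴ * a i) + (a j * (a i)ᴴ + (a i)ᴴ * a j) := by noncomm_ring
    have e11 : ((a i)ᴴ - a i) * ((a j)ᴴ - a j) + ((a j)ᴴ - a j) * ((a i)ᴴ - a i) =
        (a i * a j + a j * a i) + ((a i)ᴴ * (a j)ᴴ + (a j)ᴴ * (a i)ᴴ) -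
          (a i * (a j)ᴴ + (a j)ᴴ * a i) - (a j * (a i)ᴴ + (a i)ᴴ * a j) := by noncomm_ring
    rw [h1, h2, h3, h4] at e00 e01 e10 e11
    have hsymm : (if j = i then (1 : Matrix n n ℂ) else 0) = if i = j then 1 else 0 := by
      simp only [eq_comm]
    rw [hsymm] at e00 e01 e10 e11
    by_cases hx : x = 0 <;> by_cases hy : y = 0
    · subst hx hy
      simp only [majorana, if_true, e00, Prod.mk.injEq, and_true]
      split_ifs <;> simp [one_add_one_eq_two]
    · simp only [majorana, hx, hy, if_true, if_false, Prod.mk.injEq, (Ne.symm hy : (0 : Fin 2) ≠ y),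
        and_false, Matrix.smul_mul, Matrix.mul_smul, ← smul_add, e01]
      simp
    · simp only [majorana, hx, hy, if_true, if_false, Prod.mk.injEq,
        and_false, Matrix.smul_mul, Matrix.mul_smul, ← smul_add, e10]
      simp
    · have hxy : x = y := by omega
      subst hxy
      simp only [majorana, hx, if_false, Prod.mk.injEq,
        and_true, Matrix.smul_mul, Matrix.mul_smul, ← smul_add, smul_smul, e11]
      split_ifs
      · simp [← two_smul ℂ (1 : Matrix n n ℂ), sub_eq_add_neg]
        rw [← Algebra.algebraMap_eq_smul_one, map_ofNat]
      · simp

theorem even_card_majorana_index (m : ℕ) : Even (Fintype.card (Fin m × Fin 2)) := by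
  simp

omit [DecidableEq n] in
theorem card_sq_eq_two_pow (hn : Fintype.card n = 2 ^ m) :
    Fintype.card n ^ 2 = 2 ^ Fintype.card (Fin m × Fin 2) := by
  rw [hn, ← pow_mul]
  simp

/-- The parity operators `i c_{2k-1} c_{2k}` of the modes. -/
noncomputable def modeParity (c : Fin m × Fin 2 → Matrix n n ℂ) (k : Fin m) : Matrix n n ℂ :=
  Complex.I • (c (k, 0) * c (k, 1))

variable {c : Fin m × Fin 2 → Matrix n n ℂ}

theorem IsCliffordFamily.modeParity_commute (hc : IsCliffordFamily c) {k : Fin m}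
    {i : Fin m × Fin 2} (hi : i.1 ≠ k) : modeParity c k * c i = c i * modeParity c k := by
  have h0 : (k, (0 : Fin 2)) ≠ i := by rintro rfl; simp at hi
  have h1 : (k, (1 : Fin 2)) ≠ i := by rintro rfl; simp at hi
  rw [modeParity, Matrix.smul_mul, Matrix.mul_smul, mul_assoc, hc.mul_comm_neg h1, mul_neg,
    ← mul_assoc, hc.mul_comm_neg h0, neg_mul, neg_neg, mul_assoc]

/-- Here the m involutions act on a single copy, of dimension 2^m. Conjugation by c_{2k-1} flips the
parity of mode k alone. -/
theorem IsCliffordFamily.isQubitFamily_modeParity (hc : IsCliffordFamily c)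
    (hn : Fintype.card n = 2 ^ m) : IsQubitFamily (modeParity c) where
  card_eq := by simpa using hn
  isHermitian k := by
    rw [modeParity, Matrix.conjTranspose_smul, Matrix.conjTranspose_mul, hc.isHermitian,
      hc.isHermitian, hc.mul_comm_neg (by simp : (k, (1 : Fin 2)) ≠ (k, 0))]
    simp
  mul_self k := by
    rw [modeParity, Matrix.smul_mul, Matrix.mul_smul, smul_smul, Complex.I_mul_I, mul_assoc,
      ← mul_assoc (c (k, 1)), hc.mul_comm_neg (by simp : (k, (1 : Fin 2)) ≠ (k, 0)), neg_mul,
      mul_assoc, hc.mul_self, mul_one, mul_neg, hc.mul_self]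
    simp
  commute j k := by
    by_cases h : j = k
    · rw [h]
    · conv_lhs => rw [modeParity.eq_def c k]
      conv_rhs => rw [modeParity.eq_def c k]
      rw [Matrix.mul_smul, Matrix.smul_mul, ← mul_assoc, hc.modeParity_commute (Ne.symm h),
        mul_assoc, hc.modeParity_commute (Ne.symm h), mul_assoc]
  exists_flip k := by
    refine ⟨c (k, 0), hc.isUnit _, ?_, fun j hj => hc.modeParity_commute (Ne.symm hj)⟩
    rw [modeParity, Matrix.smul_mul, Matrix.mul_smul, mul_assoc,
      hc.mul_comm_neg (by simp : (k, (1 : Fin 2)) ≠ (k, 0)), mul_neg, smul_neg]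

end Majorana

/-! ### Entrywise integrals and Haar measure -/

section EntryIntegral

open MeasureTheory

variable {α N : Type*} [MeasurableSpace α] {μ : Measure α} [Fintype N] {F : α → Matrix N N ℂ}

theorem mul_of_integral (hF : ∀ p q, Integrable (fun x => F x p q) μ) (A : Matrix N N ℂ) :
    A * Matrix.of (fun p q => ∫ x, F x p q ∂μ) =
      Matrix.of (fun p q => ∫ x, (A * F x) p q ∂μ) := by
  ext p q
  simp only [Matrix.mul_apply, Matrix.of_apply]
  rw [integral_finsetSum _ fun k _ => (hF k q).const_mul _]
  simp only [integral_const_mul]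

theorem of_integral_mul (hF : ∀ p q, Integrable (fun x => F x p q) μ) (A : Matrix N N ℂ) :
    Matrix.of (fun p q => ∫ x, F x p q ∂μ) * A =
      Matrix.of (fun p q => ∫ x, (F x * A) p q ∂μ) := by
  ext p q
  simp only [Matrix.mul_apply, Matrix.of_apply]
  rw [integral_finsetSum _ fun k _ => (hF p k).mul_const _]
  simp only [integral_mul_const]

theorem trace_of_integral (hF : ∀ p q, Integrable (fun x => F x p q) μ) :
    Matrix.trace (Matrix.of (fun p q => ∫ x, F x p q ∂μ)) = ∫ x, Matrix.trace (F x) ∂μ := by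
  simp only [Matrix.trace, Matrix.diag_apply, Matrix.of_apply]
  rw [integral_finsetSum _ fun k _ => hF k k]

theorem integrable_mul_apply (hF : ∀ p q, Integrable (fun x => F x p q) μ) (A : Matrix N N ℂ)
    (p q : N) : Integrable (fun x => (A * F x) p q) μ := by
  simp only [Matrix.mul_apply]
  exact integrable_finsetSum _ fun k _ => (hF k q).const_mul _

end EntryIntegral

section Haar

open MeasureTheory

variable (ι : Type*) [Fintype ι] [DecidableEq ι]

instance orthogonalHaar_isHaarMeasure : (orthogonalHaar ι).IsHaarMeasure :=
  inferInstanceAs (Measure.haarMeasure ⊤).IsHaarMeasure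

instance orthogonalHaar_isProbabilityMeasure : IsProbabilityMeasure (orthogonalHaar ι) :=
  ⟨Measure.haarMeasure_self (K₀ := ⊤)⟩

/-- A right translate of a Haar probability measure is again one, and such a measure is unique. -/
instance orthogonalHaar_isMulRightInvariant : (orthogonalHaar ι).IsMulRightInvariant where
  map_mul_right_eq_self g := by
    have hm : Measurable fun x : Matrix.orthogonalGroup ι ℝ => x * g :=
      (continuous_mul_const g).measurable
    have h1 : IsProbabilityMeasure (Measure.map (· * g) (orthogonalHaar ι)) :=
      Measure.isProbabilityMeasure_map hm.aemeasurable
    exact Measure.isHaarMeasure_eq_of_isProbabilityMeasure _ _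

end Haar

/-! ### The twirl: independence of phases, continuity, invariance -/

section Twirl

open MeasureTheory

variable {ι n : Type*} [Fintype ι] [DecidableEq ι] [Fintype n] [DecidableEq n]
  {c : ι → Matrix n n ℂ}

/-- Conjugation by `W ⊗ W`. -/
noncomputable def conjTwoCopies (W : Matrix n n ℂ) (X : Matrix (n × n) (n × n) ℂ) :
    Matrix (n × n) (n × n) ℂ :=
  (W ⊗ₖ W) * X * (Wᴴ ⊗ₖ Wᴴ)

omit [DecidableEq n] in
theorem conjTwoCopies_mul (V W : Matrix n n ℂ) (X : Matrix (n × n) (n × n) ℂ) :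
    conjTwoCopies (V * W) X = conjTwoCopies V (conjTwoCopies W X) := by
  simp only [conjTwoCopies, Matrix.conjTranspose_mul, Matrix.mul_kronecker_mul, mul_assoc]

omit [DecidableEq n] in
theorem conjTwoCopies_smul (r : ℂ) (W : Matrix n n ℂ) (X : Matrix (n × n) (n × n) ℂ) :
    conjTwoCopies (r • W) X = (star r * r) ^ 2 • conjTwoCopies W X := by
  simp only [conjTwoCopies, Matrix.conjTranspose_smul, Matrix.smul_kronecker,
    Matrix.kronecker_smul, Matrix.smul_mul, Matrix.mul_smul, smul_smul]
  congr 1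
  ring

theorem unitary_mul_conjTranspose (W : Matrix.unitaryGroup n ℂ) :
    (W : Matrix n n ℂ) * (W : Matrix n n ℂ)ᴴ = 1 :=
  Matrix.mem_unitaryGroup_iff.mp W.2

theorem conjTranspose_mul_unitary (W : Matrix.unitaryGroup n ℂ) :
    (W : Matrix n n ℂ)ᴴ * (W : Matrix n n ℂ) = 1 :=
  Matrix.mem_unitaryGroup_iff'.mp W.2

theorem trace_conjTwoCopies (W : Matrix.unitaryGroup n ℂ) (X : Matrix (n × n) (n × n) ℂ) :
    Matrix.trace (conjTwoCopies (W : Matrix n n ℂ) X) = Matrix.trace X := by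
  rw [conjTwoCopies, Matrix.trace_mul_comm, ← mul_assoc, ← Matrix.mul_kronecker_mul,
    conjTranspose_mul_unitary, Matrix.one_kronecker_one, one_mul]

omit [DecidableEq ι] in
-- The order reverses: conjugation by V acts linearly on the sums ∑ R_ij c_j, so Q multiplies R from
-- the right. This is why right invariance of the Haar measure is used.
theorem Induces.mul {V W : Matrix.unitaryGroup n ℂ} {Q R : Matrix ι ι ℝ} (hV : Induces c V Q)
    (hW : Induces c W R) : Induces c (V * W) (R * Q) := by
  intro i
  have h1 : ((V * W : Matrix.unitaryGroup n ℂ) : Matrix n n ℂ) * c i *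
      ((V * W : Matrix.unitaryGroup n ℂ) : Matrix n n ℂ)ᴴ =
      V * (W * c i * (W : Matrix n n ℂ)ᴴ) * (V : Matrix n n ℂ)ᴴ := by
    simp [Matrix.conjTranspose_mul, mul_assoc]
  rw [h1, hW i, rotated, Finset.mul_sum, Finset.sum_mul]
  simp only [Matrix.mul_smul, Matrix.smul_mul, hV _, rotated, Finset.smul_sum, smul_smul,
    Matrix.mul_apply, Complex.ofReal_sum, Complex.ofReal_mul, Finset.sum_smul]
  exact Finset.sum_comm

/-- WᴴV commutes with all generators, so Schur's lemma makes it a scalar. -/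
theorem IsCliffordFamily.exists_smul_of_induces (hc : IsCliffordFamily c)
    (hι : Even (Fintype.card ι)) (hn : Fintype.card n ^ 2 = 2 ^ Fintype.card ι)
    {V W : Matrix.unitaryGroup n ℂ} {R : Matrix ι ι ℝ} (hV : Induces c V R)
    (hW : Induces c W R) : ∃ r : ℂ, star r * r = 1 ∧ (V : Matrix n n ℂ) = r • (W : Matrix n n ℂ) := by
  obtain ⟨j⟩ := nonempty_of_card hn
  have hVc : ∀ i, (V : Matrix n n ℂ) * c i = rotated R c i * V := by
    intro i
    rw [← hV i, mul_assoc, conjTranspose_mul_unitary, mul_one]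
  have hWc : ∀ i, (W : Matrix n n ℂ)ᴴ * rotated R c i = c i * (W : Matrix n n ℂ)ᴴ := by
    intro i
    rw [← hW i, ← mul_assoc, ← mul_assoc, conjTranspose_mul_unitary, one_mul]
  obtain ⟨r, hr⟩ := hc.eq_smul_one_of_commute hι hn (M := (W : Matrix n n ℂ)ᴴ * V) fun i => by
    rw [← mul_assoc, ← hWc, mul_assoc, mul_assoc, hVc]
  have hVW : (V : Matrix n n ℂ) = r • (W : Matrix n n ℂ) := by
    have := congrArg ((W : Matrix n n ℂ) * ·) hr
    simpa only [← mul_assoc, unitary_mul_conjTranspose, one_mul, Matrix.mul_smul, mul_one]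
      using this
  refine ⟨r, ?_, hVW⟩
  have h1 := conjTranspose_mul_unitary V
  rw [hVW, Matrix.conjTranspose_smul, Matrix.smul_mul, Matrix.mul_smul, smul_smul,
    conjTranspose_mul_unitary] at h1
  simpa using congrArg (fun M : Matrix n n ℂ => M j j) h1

theorem IsCliffordFamily.conjTwoCopies_eq_of_induces (hc : IsCliffordFamily c)
    (hι : Even (Fintype.card ι)) (hn : Fintype.card n ^ 2 = 2 ^ Fintype.card ι)
    {V W : Matrix.unitaryGroup n ℂ} {R : Matrix ι ι ℝ} (hV : Induces c V R)
    (hW : Induces c W R) (X : Matrix (n × n) (n × n) ℂ) :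
    conjTwoCopies (V : Matrix n n ℂ) X = conjTwoCopies (W : Matrix n n ℂ) X := by
  obtain ⟨r, hr, hVW⟩ := hc.exists_smul_of_induces hι hn hV hW
  rw [hVW, conjTwoCopies_smul, hr, one_pow, one_smul]

variable {U : Matrix.orthogonalGroup ι ℝ → Matrix.unitaryGroup n ℂ}

/-- R ↦ U_R itself may be discontinuous because of its phases. Conjugation is multiplicative and
linear in E, and on each generator it is linear in the entries of R; the generators produce every E.
-/
theorem IsCliffordFamily.continuous_conj (hc : IsCliffordFamily c)
    (hι : Even (Fintype.card ι)) (hn : Fintype.card n ^ 2 = 2 ^ Fintype.card ι)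
    (hU : ∀ R, Induces c (U R) R) (E : Matrix n n ℂ) :
    Continuous fun R => (U R : Matrix n n ℂ) * E * (U R : Matrix n n ℂ)ᴴ := by
  have hE : E ∈ Algebra.adjoin ℂ (Set.range c) := by
    rw [hc.adjoin_eq_top hι hn]
    trivial
  induction hE using Algebra.adjoin_induction with
  | mem x hx =>
    obtain ⟨i, rfl⟩ := hx
    have : (fun R => (U R : Matrix n n ℂ) * c i * (U R : Matrix n n ℂ)ᴴ) =
        fun R : Matrix.orthogonalGroup ι ℝ => ∑ j, ((R : Matrix ι ι ℝ) i j : ℂ) • c j :=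
      funext fun R => hU R i
    rw [this]
    refine continuous_finsetSum _ fun j _ => Continuous.fun_smul ?_ continuous_const
    exact Complex.continuous_ofReal.comp (continuous_subtype_val.matrix_elem i j)
  | algebraMap r =>
    have : (fun R => (U R : Matrix n n ℂ) * algebraMap ℂ (Matrix n n ℂ) r *
        (U R : Matrix n n ℂ)ᴴ) = fun _ => algebraMap ℂ (Matrix n n ℂ) r := by
      funext R
      rw [← Algebra.commutes, mul_assoc, unitary_mul_conjTranspose, mul_one]
    rw [this]
    exact continuous_const
  | add x y _ _ hx hy =>
    simp only [mul_add, add_mul]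
    exact hx.add hy
  | mul x y _ _ hx hy =>
    have : (fun R => (U R : Matrix n n ℂ) * (x * y) * (U R : Matrix n n ℂ)ᴴ) =
        fun R => ((U R : Matrix n n ℂ) * x * (U R : Matrix n n ℂ)ᴴ) *
          ((U R : Matrix n n ℂ) * y * (U R : Matrix n n ℂ)ᴴ) := by
      funext R
      simp only [mul_assoc]
      rw [← mul_assoc (U R : Matrix n n ℂ)ᴴ (U R : Matrix n n ℂ), conjTranspose_mul_unitary,
        one_mul]
    rw [this]
    exact hx.matrix_mul hy

theorem IsCliffordFamily.continuous_twirlIntegrand (hc : IsCliffordFamily c)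
    (hι : Even (Fintype.card ι)) (hn : Fintype.card n ^ 2 = 2 ^ Fintype.card ι)
    (hU : ∀ R, Induces c (U R) R) (X : Matrix (n × n) (n × n) ℂ) :
    Continuous (twirlIntegrand U X) := by
  -- Splitting X into tensor products of matrix units reduces the two-copy conjugation to one-copy
  -- conjugations.
  have hX : X = ∑ p, ∑ q, X p q • (Matrix.single p.1 q.1 (1 : ℂ) ⊗ₖ Matrix.single p.2 q.2 (1 : ℂ)) := by
    conv_lhs => rw [Matrix.matrix_eq_sum_single X]
    refine Finset.sum_congr rfl fun p _ => Finset.sum_congr rfl fun q _ => ?_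
    rw [Matrix.single_kronecker_single, Matrix.smul_single]
    simp
  have h : twirlIntegrand U X = fun R => ∑ p, ∑ q, X p q •
      (((U R : Matrix n n ℂ) * Matrix.single p.1 q.1 (1 : ℂ) * (U R : Matrix n n ℂ)ᴴ) ⊗ₖ
        ((U R : Matrix n n ℂ) * Matrix.single p.2 q.2 (1 : ℂ) * (U R : Matrix n n ℂ)ᴴ)) := by
    funext R
    conv_lhs => rw [hX]
    simp only [twirlIntegrand, Finset.mul_sum, Finset.sum_mul, Matrix.mul_smul, Matrix.smul_mul,
      Matrix.mul_kronecker_mul]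
  rw [h]
  refine continuous_finsetSum _ fun p _ => continuous_finsetSum _ fun q _ =>
    Continuous.fun_const_smul ?_ _
  refine continuous_matrix fun i j => ?_
  simp only [Matrix.kroneckerMap_apply]
  exact ((hc.continuous_conj hι hn hU _).matrix_elem _ _).mul
    ((hc.continuous_conj hι hn hU _).matrix_elem _ _)

theorem IsCliffordFamily.integrable_twirlIntegrand (hc : IsCliffordFamily c)
    (hι : Even (Fintype.card ι)) (hn : Fintype.card n ^ 2 = 2 ^ Fintype.card ι)
    (hU : ∀ R, Induces c (U R) R) (X : Matrix (n × n) (n × n) ℂ) (p q : n × n) :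
    Integrable (fun R => twirlIntegrand U X R p q) (orthogonalHaar ι) :=
  ((hc.continuous_twirlIntegrand hι hn hU X).matrix_elem p q).integrable_of_hasCompactSupport
    (HasCompactSupport.of_compactSpace _)

theorem IsCliffordFamily.conjTwoCopies_floTwirl (hc : IsCliffordFamily c)
    (hι : Even (Fintype.card ι)) (hn : Fintype.card n ^ 2 = 2 ^ Fintype.card ι)
    (hU : ∀ R, Induces c (U R) R) (X : Matrix (n × n) (n × n) ℂ) {W : Matrix.unitaryGroup n ℂ}
    {Q : Matrix.orthogonalGroup ι ℝ} (hW : Induces c W Q) :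
    conjTwoCopies (W : Matrix n n ℂ) (floTwirl U X) = floTwirl U X := by
  have hint := hc.integrable_twirlIntegrand hι hn hU X
  have h1 : ∀ R, (W : Matrix n n ℂ) ⊗ₖ (W : Matrix n n ℂ) * twirlIntegrand U X R *
      ((W : Matrix n n ℂ)ᴴ ⊗ₖ (W : Matrix n n ℂ)ᴴ) = twirlIntegrand U X (R * Q) := by
    intro R
    -- W U_R and U_{RQ} induce the same rotation, so they differ by a phase, which conjugation on
    -- two copies does not see.
    have h2 := hc.conjTwoCopies_eq_of_induces hι hn (hW.mul (hU R)) (hU (R * Q)) X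
    rw [show ((W * U R : Matrix.unitaryGroup n ℂ) : Matrix n n ℂ) = W * U R from rfl,
      conjTwoCopies_mul] at h2
    exact h2
  rw [conjTwoCopies, floTwirl, mul_of_integral hint,
    of_integral_mul (integrable_mul_apply hint _)]
  ext p q
  simp only [Matrix.of_apply, h1]
  exact integral_mul_right_eq_self (fun R => twirlIntegrand U X R p q) Q

/-- Applied with B = 0 to show that Λ kills the twirl, and with A a projection and B = 1 to locate
its range. -/
theorem IsCliffordFamily.mul_floTwirl (hc : IsCliffordFamily c)
    (hι : Even (Fintype.card ι)) (hn : Fintype.card n ^ 2 = 2 ^ Fintype.card ι)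
    (hU : ∀ R, Induces c (U R) R) (X : Matrix (n × n) (n × n) ℂ)
    {A B : Matrix (n × n) (n × n) ℂ}
    (h : ∀ R, A * twirlIntegrand U X R = B * twirlIntegrand U X R) :
    A * floTwirl U X = B * floTwirl U X := by
  have hint := hc.integrable_twirlIntegrand hι hn hU X
  rw [floTwirl, mul_of_integral hint, mul_of_integral hint]
  simp only [h]

theorem IsCliffordFamily.trace_floTwirl (hc : IsCliffordFamily c)
    (hι : Even (Fintype.card ι)) (hn : Fintype.card n ^ 2 = 2 ^ Fintype.card ι)
    (hU : ∀ R, Induces c (U R) R) (X : Matrix (n × n) (n × n) ℂ) :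
    Matrix.trace (floTwirl U X) = Matrix.trace X := by
  rw [floTwirl, trace_of_integral (hc.integrable_twirlIntegrand hι hn hU X)]
  have : ∀ R, Matrix.trace (twirlIntegrand U X R) = Matrix.trace X := fun R =>
    trace_conjTwoCopies (U R) X
  simp [this]

end Twirl

/-! ### Product vectors, rank-one operators and traces -/

section TensorVec

variable {n : Type*}

theorem tensorVec_smul (r s : ℂ) (x y : EuclideanSpace ℂ n) :
    tensorVec (r • x) (s • y) = (r * s) • tensorVec x y := by
  ext p
  simp [tensorVec]
  ring

variable [Fintype n] [DecidableEq n]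

theorem euclOp_kronecker_tensorVec (A B : Matrix n n ℂ) (x y : EuclideanSpace ℂ n) :
    euclOp (A ⊗ₖ B) (tensorVec x y) = tensorVec (euclOp A x) (euclOp B y) := by
  rw [tensorVec, euclOp_toLp, tensorVec]
  congr 1
  ext p
  simp only [ofLp_euclOp, Matrix.mulVec, dotProduct, Matrix.kroneckerMap_apply,
    Finset.sum_mul_sum, Fintype.sum_prod_type]
  exact Finset.sum_congr rfl fun i _ => Finset.sum_congr rfl fun j _ => by ring

theorem euclOp_ketBra (x y : EuclideanSpace ℂ n) : euclOp (ketBra x) y = inner ℂ x y • x := by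
  ext i
  rw [ofLp_euclOp, ketBra, Matrix.vecMulVec_mulVec]
  simp [EuclideanSpace.inner_eq_star_dotProduct, dotProduct_comm, mul_comm]

theorem mul_ketBra_mul_conjTranspose (A : Matrix n n ℂ) (x : EuclideanSpace ℂ n) :
    A * ketBra x * Aᴴ = ketBra (euclOp A x) := by
  simp only [ketBra, ofLp_euclOp, Matrix.mul_vecMulVec, Matrix.vecMulVec_mul, Matrix.star_mulVec]

theorem conjTwoCopies_ketBra_tensorVec (W : Matrix n n ℂ) (x : EuclideanSpace ℂ n) :
    conjTwoCopies W (ketBra (tensorVec x x)) =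
      ketBra (tensorVec (euclOp W x) (euclOp W x)) := by
  rw [conjTwoCopies, ← Matrix.conjTranspose_kronecker, mul_ketBra_mul_conjTranspose,
    euclOp_kronecker_tensorVec]

omit [DecidableEq n] in
theorem trace_ketBra (x : EuclideanSpace ℂ n) : Matrix.trace (ketBra x) = inner ℂ x x := by
  rw [ketBra, Matrix.trace_vecMulVec, EuclideanSpace.inner_eq_star_dotProduct]

omit [DecidableEq n] in
theorem inner_tensorVec_self (x : EuclideanSpace ℂ n) :
    inner ℂ (tensorVec x x) (tensorVec x x) = inner ℂ x x * inner ℂ x x := by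
  simp only [EuclideanSpace.inner_eq_star_dotProduct, tensorVec, dotProduct,
    Finset.sum_mul_sum, Fintype.sum_prod_type, Pi.star_apply, star_mul']
  exact Finset.sum_congr rfl fun i _ => Finset.sum_congr rfl fun j _ => by ring

theorem norm_euclOp_unitary (W : Matrix.unitaryGroup n ℂ) (x : EuclideanSpace ℂ n) :
    ‖euclOp (W : Matrix n n ℂ) x‖ = ‖x‖ := by
  have h : inner ℂ (euclOp (W : Matrix n n ℂ) x) (euclOp (W : Matrix n n ℂ) x) = inner ℂ x x := by
    rw [inner_euclOp_left, ← euclOp_mul, conjTranspose_mul_unitary, euclOp_one]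
  rw [@norm_eq_sqrt_re_inner ℂ, @norm_eq_sqrt_re_inner ℂ, h]

theorem trace_eq_sum_inner_euclOp {κ : Type*} [Fintype κ]
    (b : OrthonormalBasis κ ℂ (EuclideanSpace ℂ n)) (M : Matrix n n ℂ) :
    Matrix.trace M = ∑ k, inner ℂ (b k) (euclOp M (b k)) := by
  have h : Matrix.trace M = LinearMap.trace ℂ _ (Matrix.toEuclideanLin M) := by
    rw [Matrix.toEuclideanLin_eq_toLin_orthonormal,
      LinearMap.trace_eq_matrix_trace ℂ (EuclideanSpace.basisFun n ℂ).toBasis,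
      LinearMap.toMatrix_toLin]
  rw [h, LinearMap.trace_eq_sum_inner _ b]
  rfl

end TensorVec

/-! ### Reflections and permutations of the generators -/

section SignedPermutations

variable {ι n : Type*} [Fintype ι] [DecidableEq ι] [Fintype n] [DecidableEq n]
  {c : ι → Matrix n n ℂ}

theorem diagonal_mem_orthogonalGroup {d : ι → ℝ} (hd : ∀ i, d i * d i = 1) :
    Matrix.diagonal d ∈ Matrix.orthogonalGroup ι ℝ := by
  rw [Matrix.mem_orthogonalGroup_iff, Matrix.diagonal_transpose,
    Matrix.diagonal_mul_diagonal, ← Matrix.diagonal_one]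
  congr 1
  ext i
  simpa using hd i

omit [Fintype n] [DecidableEq n] in
theorem rotated_diagonal (d : ι → ℝ) (i : ι) :
    rotated (Matrix.diagonal d) c i = (d i : ℂ) • c i := by
  rw [rotated, Finset.sum_eq_single i]
  · simp
  · intro j _ hj
    simp [Matrix.diagonal_apply_ne' d hj]
  · simp

omit [DecidableEq ι] [Fintype n] [DecidableEq n] in
theorem rotated_mul (Q R : Matrix ι ι ℝ) : rotated (Q * R) c = rotated Q (rotated R c) := by
  funext i
  simp only [rotated, Finset.smul_sum, smul_smul, Matrix.mul_apply, Complex.ofReal_sum,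
    Complex.ofReal_mul, Finset.sum_smul]
  exact Finset.sum_comm

/-- The orthogonal matrix of a permutation. -/
def permutationMatrix (σ : Equiv.Perm ι) : Matrix ι ι ℝ :=
  Matrix.of fun i j => if σ i = j then 1 else 0

theorem permutationMatrix_mem_orthogonalGroup (σ : Equiv.Perm ι) :
    permutationMatrix σ ∈ Matrix.orthogonalGroup ι ℝ := by
  rw [Matrix.mem_orthogonalGroup_iff]
  ext i j
  simp [permutationMatrix, Matrix.mul_apply, Matrix.one_apply, eq_comm]

omit [Fintype n] [DecidableEq n] in
theorem rotated_permutationMatrix (σ : Equiv.Perm ι) (i : ι) :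
    rotated (permutationMatrix σ) c i = c (σ i) := by
  rw [rotated, Finset.sum_eq_single (σ i)]
  · simp [permutationMatrix]
  · intro j _ hj
    simp [permutationMatrix, Ne.symm hj]
  · simp

/-- As a consequence, an operator invariant under all induced conjugations commutes with every c_j ⊗
c_j. -/
theorem IsCliffordFamily.induces_self (hc : IsCliffordFamily c) (j : ι) :
    Induces c ⟨c j, hc.mem_unitaryGroup j⟩
      (Matrix.diagonal fun i => if i = j then (1 : ℝ) else -1) := by
  intro i
  rw [rotated_diagonal]
  change c j * c i * (c j)ᴴ = _
  rw [hc.isHermitian]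
  by_cases h : i = j
  · subst h
    simp [hc.mul_self]
  · rw [hc.mul_comm_neg (Ne.symm h), neg_mul, mul_assoc, hc.mul_self]
    simp [h]

theorem exists_perm_mem_iff {A B : Finset ι} (h : A.card = B.card) :
    ∃ σ : Equiv.Perm ι, ∀ i, σ i ∈ B ↔ i ∈ A := by
  have e : {x // x ∈ A} ≃ {x // x ∈ B} := Fintype.equivOfCardEq (by simpa using h)
  refine ⟨e.extendSubtype, fun i => ⟨fun hi => ?_, e.extendSubtype_mem i⟩⟩
  by_contra hA
  exact e.extendSubtype_not_mem i hA hi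

end SignedPermutations

/-! ### Invariant operators and the projector onto the null space -/

namespace IsCliffordFamily

variable {ι n : Type*} [Fintype ι] [DecidableEq ι] [Fintype n] [DecidableEq n]
  {c : ι → Matrix n n ℂ}

theorem euclOp_lambdaOp {b : Finset ι → EuclideanSpace ℂ (n × n)}
    (hb : ∀ A i, euclOp (c i ⊗ₖ c i) (b A) = memSign A i • b A) (A : Finset ι) :
    euclOp (lambdaOp c) (b A) = (2 * A.card - Fintype.card ι : ℂ) • b A := by
  have h : ∑ i, memSign A i = (2 * A.card - Fintype.card ι : ℂ) := by
    have : ∀ i, memSign A i = 2 * (if i ∈ A then 1 else 0) - 1 := by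
      intro i
      unfold memSign
      split_ifs <;> norm_num
    simp only [this, Finset.sum_sub_distrib, ← Finset.mul_sum, Finset.sum_ite_mem]
    simp
  rw [lambdaOp, euclOp_sum]
  simp only [hb, ← Finset.sum_smul, h]

theorem commute_of_conjTwoCopies {W : Matrix.unitaryGroup n ℂ} {S : Matrix (n × n) (n × n) ℂ}
    (h : conjTwoCopies (W : Matrix n n ℂ) S = S) :
    S * ((W : Matrix n n ℂ) ⊗ₖ (W : Matrix n n ℂ)) =
      ((W : Matrix n n ℂ) ⊗ₖ (W : Matrix n n ℂ)) * S := by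
  conv_lhs => rw [← h]
  rw [conjTwoCopies, mul_assoc, ← Matrix.mul_kronecker_mul, conjTranspose_mul_unitary,
    Matrix.one_kronecker_one, mul_one]

variable {S : Matrix (n × n) (n × n) ℂ}

/-- An operator commuting with all `U_R ⊗ U_R` is diagonal in the joint eigenbasis of the
`cᵢ ⊗ cᵢ`, with eigenvalues that depend only on the number of positive signs. -/
theorem exists_eigenvalue_of_invariant (hc : IsCliffordFamily c)
    (hι : Even (Fintype.card ι)) (hn : Fintype.card n ^ 2 = 2 ^ Fintype.card ι)
    (hS : ∀ (Q : Matrix.orthogonalGroup ι ℝ) (W : Matrix.unitaryGroup n ℂ), Induces c W Q →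
      conjTwoCopies (W : Matrix n n ℂ) S = S)
    {b : OrthonormalBasis (Finset ι) ℂ (EuclideanSpace ℂ (n × n))}
    (hb : ∀ A i, euclOp (c i ⊗ₖ c i) (b A) = memSign A i • b A) :
    ∃ f : Finset ι → ℂ, (∀ A, euclOp S (b A) = f A • b A) ∧
      ∀ A B, A.card = B.card → f A = f B := by
  have hT := hc.isQubitFamily_kronecker hc hι hn
  have hST : ∀ j, S * (c j ⊗ₖ c j) = (c j ⊗ₖ c j) * S := fun j =>
    commute_of_conjTwoCopies (W := ⟨c j, hc.mem_unitaryGroup j⟩)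
      (hS ⟨Matrix.diagonal fun i => if i = j then (1 : ℝ) else -1,
        diagonal_mem_orthogonalGroup fun i => by split_ifs <;> norm_num⟩ _ (hc.induces_self j))
  -- S commutes with the involutions, so it preserves each joint eigenspace, and these are lines.
  have hdiag : ∀ A, ∃ s : ℂ, euclOp S (b A) = s • b A := fun A =>
    ⟨_, hT.eq_smul_of_joint_eigenvector hb fun i => by
      rw [← euclOp_mul, ← hST, euclOp_mul, hb, map_smul]⟩
  choose f hf using hdiag
  refine ⟨f, hf, fun A B hAB => ?_⟩
  obtain ⟨σ, hσ⟩ := exists_perm_mem_iff hAB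
  obtain ⟨W, hW⟩ := hc.exists_induces hι hn ⟨_, permutationMatrix_mem_orthogonalGroup σ⟩
  have hWc : ∀ i, c (σ i) * (W : Matrix n n ℂ) = W * c i := by
    intro i
    have h := hW i
    rw [rotated_permutationMatrix] at h
    rw [← h, mul_assoc, conjTranspose_mul_unitary, mul_one]
  have hSW := commute_of_conjTwoCopies (hS _ W hW)
  set V := (W : Matrix n n ℂ) ⊗ₖ (W : Matrix n n ℂ) with hV
  have hVu : Vᴴ * V = 1 := by
    rw [hV, Matrix.conjTranspose_kronecker, ← Matrix.mul_kronecker_mul, conjTranspose_mul_unitary,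
      Matrix.one_kronecker_one]
  have hVb0 : euclOp V (b A) ≠ 0 := by
    intro h
    apply b.orthonormal.ne_zero A
    rw [← euclOp_one (b A), ← hVu, euclOp_mul, h, map_zero]
  -- The permutation carries A to B, so V maps the line of A to the line of B; S commutes with V,
  -- hence f A = f B.
  have hVb := hT.eq_smul_of_joint_eigenvector hb (A := B) (v := euclOp V (b A)) fun j => by
    obtain ⟨i, rfl⟩ := σ.surjective j
    have hs : memSign B (σ i) = memSign A i := by simp only [memSign, hσ]
    rw [← euclOp_mul, hV, ← Matrix.mul_kronecker_mul, hWc, Matrix.mul_kronecker_mul, euclOp_mul,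
      hb, map_smul, hs]
  have h1 : euclOp S (euclOp V (b A)) = f A • euclOp V (b A) := by
    rw [← euclOp_mul, hSW, euclOp_mul, hf, map_smul]
  have h2 : euclOp S (euclOp V (b A)) = f B • euclOp V (b A) := by
    rw [hVb, map_smul, hf, smul_comm]
  exact smul_left_injective ℂ hVb0 (h1.symm.trans h2)

/-- The only invariant operator of trace one that is annihilated by `Λ` is the normalized projector
onto the null space of `Λ`. -/
theorem starProjection_lambdaNullSpace_eq (hc : IsCliffordFamily c) {k : ℕ}
    (hk : Fintype.card ι = 2 * k) (hn : Fintype.card n ^ 2 = 2 ^ Fintype.card ι)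
    (hS : ∀ (Q : Matrix.orthogonalGroup ι ℝ) (W : Matrix.unitaryGroup n ℂ), Induces c W Q →
      conjTwoCopies (W : Matrix n n ℂ) S = S)
    (hΛ : lambdaOp c * S = 0) (htr : Matrix.trace S = 1) :
    (lambdaNullSpace c).starProjection = euclOp (((2 * k).choose k : ℂ) • S) := by
  have hι : Even (Fintype.card ι) := hk ▸ even_two_mul k
  have hT := hc.isQubitFamily_kronecker hc hι hn
  obtain ⟨b, hb⟩ := hT.exists_orthonormalBasis
  obtain ⟨f, hf, hfc⟩ := hc.exists_eigenvalue_of_invariant hι hn hS hb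
  have hΛb := euclOp_lambdaOp (fun A => hb A)
  have hne : ∀ A : Finset ι, A.card ≠ k → (2 * A.card - Fintype.card ι : ℂ) ≠ 0 := by
    intro A hA h
    rw [hk, sub_eq_zero] at h
    have : 2 * A.card = 2 * k := by exact_mod_cast h
    omega
  have hf0 : ∀ A : Finset ι, A.card ≠ k → f A = 0 := by
    intro A hA
    have h : euclOp (lambdaOp c * S) (b A) = 0 := by rw [hΛ, euclOp_zero]
    rw [euclOp_mul, hf, map_smul, hΛb, smul_smul] at h
    rcases smul_eq_zero.mp h with h | h
    · exact (mul_eq_zero.mp h).resolve_right (hne A hA)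
    · exact absurd h (b.orthonormal.ne_zero A)
  -- Only the binom(2k, k) patterns of size k contribute to the trace, all with the same eigenvalue.
  have hf1 : ∀ A : Finset ι, A.card = k → ((2 * k).choose k : ℂ) * f A = 1 := by
    intro A hA
    rw [trace_eq_sum_inner_euclOp b] at htr
    have h1 : ∀ B, inner ℂ (b B) (euclOp S (b B)) = if B.card = k then f A else 0 := by
      intro B
      rw [hf, inner_smul_right, inner_self_eq_norm_sq_to_K, b.orthonormal.1 B]
      split_ifs with h
      · simp [hfc B A (h.trans hA.symm)]
      · simp [hf0 B h]
    simp only [h1] at htr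
    rw [← Finset.sum_filter, Finset.sum_const, Finset.univ_filter_card_eq,
      Finset.card_powersetCard, Finset.card_univ, hk, nsmul_eq_mul] at htr
    exact htr
  have hherm : (lambdaOp c)ᴴ = lambdaOp c := by
    simp only [lambdaOp, Matrix.conjTranspose_sum, Matrix.conjTranspose_kronecker, hc.isHermitian]
  have hmem : ∀ x, x ∈ lambdaNullSpace c ↔ euclOp (lambdaOp c) x = 0 := fun x => Iff.rfl
  have key : ∀ A, (lambdaNullSpace c).starProjection (b A) =
      euclOp (((2 * k).choose k : ℂ) • S) (b A) := by
    intro A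
    rw [euclOp_smul, hf, smul_smul]
    by_cases hA : A.card = k
    · rw [hf1 A hA, one_smul, Submodule.starProjection_eq_self_iff, hmem, hΛb, hA, hk]
      simp
    -- Λ is Hermitian, so an eigenvector with nonzero eigenvalue is orthogonal to its null space.
    · rw [hf0 A hA, mul_zero, zero_smul, Submodule.starProjection_apply_eq_zero_iff]
      intro x hx
      have h := inner_euclOp_left (lambdaOp c) x (b A)
      rw [hherm, (hmem x).mp hx, inner_zero_left, hΛb, inner_smul_right] at h
      exact (mul_eq_zero.mp h.symm).resolve_left (hne A hA)
  ext1 x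
  rw [← b.sum_repr' x, map_sum, map_sum]
  simp only [map_smul, key]

end IsCliffordFamily

/-! ### Gaussian states and vacua -/

section Gaussian

variable {m : ℕ} {n : Type*} [Fintype n] [DecidableEq n] {c : Fin m × Fin 2 → Matrix n n ℂ}

theorem IsCliffordFamily.euclOp_fst_of_modeParity (hc : IsCliffordFamily c) {k : Fin m} {s : ℂ}
    {w : EuclideanSpace ℂ n} (hw : euclOp (modeParity c k) w = s • w) (hs : s * s = 1) :
    euclOp (c (k, 0)) w = (s * Complex.I) • euclOp (c (k, 1)) w := by
  have h := congrArg (euclOp (c (k, 0))) hw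
  rw [modeParity, euclOp_smul, map_smul, euclOp_mul, ← euclOp_mul, hc.mul_self, euclOp_one,
    map_smul] at h
  rw [mul_smul, h, smul_smul, hs, one_smul]

/-- Two copies of a joint eigenvector of the mode parities are annihilated by `Λ`. -/
theorem IsCliffordFamily.euclOp_lambdaOp_tensorVec (hc : IsCliffordFamily c)
    {w : EuclideanSpace ℂ n}
    (hw : ∀ k, ∃ s : ℂ, s * s = 1 ∧ euclOp (modeParity c k) w = s • w) :
    euclOp (lambdaOp c) (tensorVec w w) = 0 := by
  rw [lambdaOp, euclOp_sum, Fintype.sum_prod_type]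
  refine Finset.sum_eq_zero fun k _ => ?_
  obtain ⟨s, hs, hsw⟩ := hw k
  simp only [Fin.sum_univ_two, euclOp_kronecker_tensorVec, hc.euclOp_fst_of_modeParity hsw hs,
    tensorVec_smul]
  -- On w, c_{2k-1} equals s i c_{2k}, and (s i)² = -1, so the two terms of mode k cancel.
  have : s * Complex.I * (s * Complex.I) = -1 := by
    rw [mul_mul_mul_comm, hs, Complex.I_mul_I, one_mul]
  rw [this, neg_smul, one_smul, neg_add_cancel]

theorem euclOp_prod_ofFn {f : Fin m → Matrix n n ℂ} {μ : Fin m → ℂ} {v : EuclideanSpace ℂ n}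
    (h : ∀ k, euclOp (f k) v = μ k • v) : euclOp (List.ofFn f).prod v = (∏ k, μ k) • v := by
  induction m with
  | zero => simp [euclOp_one]
  | succ m ih =>
    rw [List.ofFn_succ, List.prod_cons, euclOp_mul, ih fun k => h k.succ, map_smul, h,
      Fin.prod_univ_succ, smul_smul, mul_comm]

/-- A unit joint eigenvector of the mode parities is given by a Gaussian density operator. -/
theorem IsCliffordFamily.ketBra_eq_of_modeParity (hc : IsCliffordFamily c)
    (hn : Fintype.card n = 2 ^ m) {w : EuclideanSpace ℂ n} (hw1 : ‖w‖ = 1) {l : Fin m → ℝ}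
    (hl : ∀ k, l k = 1 ∨ l k = -1) (hw : ∀ k, euclOp (modeParity c k) w = (l k : ℂ) • w) :
    ketBra w = ((2 : ℂ) ^ m)⁻¹ • (List.ofFn fun k : Fin m =>
      (1 : Matrix n n ℂ) + (Complex.I * (l k : ℂ)) • (c (k, 0) * c (k, 1))).prod := by
  have hZ := hc.isQubitFamily_modeParity hn
  obtain ⟨b, hb⟩ := hZ.exists_orthonormalBasis
  set A₀ : Finset (Fin m) := Finset.univ.filter fun k => l k = 1 with hA₀
  have hlA : ∀ k, (l k : ℂ) = memSign A₀ k := by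
    intro k
    rcases hl k with h | h
    · simp [memSign, hA₀, h]
    · have : ¬ (-1 : ℝ) = 1 := by norm_num
      simp [memSign, hA₀, h, this]
  have hw' : ∀ k, euclOp (modeParity c k) w = memSign A₀ k • w := fun k => by rw [hw, hlA]
  have hwb := hZ.eq_smul_of_joint_eigenvector hb hw'
  -- Each factor acts as 2 where the signs of A and A₀ agree and as 0 where they differ. The product
  -- is thus 2^m on the line of A₀ and 0 on all the others.
  have hfac : ∀ A k, euclOp ((1 : Matrix n n ℂ) + (Complex.I * (l k : ℂ)) • (c (k, 0) * c (k, 1)))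
      (b A) = (1 + memSign A₀ k * memSign A k) • b A := by
    intro A k
    rw [euclOp_add, euclOp_one, mul_comm, mul_smul, euclOp_smul, ← modeParity, hb, smul_smul,
      hlA, add_smul, one_smul]
  have hne : inner ℂ (b A₀) w ≠ 0 := by
    intro h
    rw [h, zero_smul] at hwb
    simp [hwb] at hw1
  refine ext_euclOp_basis b fun A => ?_
  rw [euclOp_ketBra, euclOp_smul, euclOp_prod_ofFn (hfac A), smul_smul]
  by_cases hA : A = A₀
  · rw [hA]
    simp only [memSign_mul_self, one_add_one_eq_two, Finset.prod_const, Finset.card_univ,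
      Fintype.card_fin]
    rw [inv_mul_cancel₀ (pow_ne_zero m two_ne_zero), one_smul]
    have hbw : b A₀ = (inner ℂ (b A₀) w)⁻¹ • w := (eq_inv_smul_iff₀ hne).mpr hwb.symm
    conv_rhs => rw [hbw]
    congr 1
    -- w and b A₀ are unit vectors on one line, so their overlap has modulus one and its conjugate
    -- is its inverse.
    apply eq_inv_of_mul_eq_one_left
    have h1 : inner ℂ w w = inner ℂ w (inner ℂ (b A₀) w • b A₀) := congrArg (inner ℂ w) hwb
    rw [inner_smul_right, inner_self_eq_norm_sq_to_K, hw1] at h1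
    rw [mul_comm, ← h1]
    simp
  · rw [hZ.inner_eq_zero (Ne.symm hA) hw' (hb A), zero_smul]
    obtain ⟨k, hk⟩ := exists_memSign_ne hA
    have hk' : 1 + memSign A₀ k * memSign A k = 0 := by
      by_cases h1 : k ∈ A <;> by_cases h2 : k ∈ A₀ <;> simp [memSign, h1, h2] at hk ⊢
    rw [Finset.prod_eq_zero (Finset.mem_univ k) hk', mul_zero, zero_smul]

variable {a : Fin m → Matrix n n ℂ}

/-- Annihilation says c̃_{2k-1} v = i c̃_{2k} v; applying c̃_{2k-1} gives parity +1. -/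
theorem modeParity_of_isGaussianVacuum (ha : IsFermionicModes a) {R : Matrix _ _ ℝ}
    (hR : R ∈ Matrix.orthogonalGroup (Fin m × Fin 2) ℝ) {v : EuclideanSpace ℂ n}
    {k : Fin m} (hv : rotatedAnnihilation a R k *ᵥ v.ofLp = 0) :
    euclOp (modeParity (rotated R (majorana a)) k) v = v := by
  have hc := ha.isCliffordFamily.rotated_orthogonal hR
  set c := rotated R (majorana a) with hcdef
  have h : euclOp (rotatedAnnihilation a R k) v = 0 := by
    rw [← WithLp.toLp_ofLp 2 v, euclOp_toLp, hv, WithLp.toLp_zero]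
  rw [rotatedAnnihilation, euclOp_smul, ← hcdef, euclOp_sub, euclOp_smul] at h
  have h1 : euclOp (c (k, 0)) v = Complex.I • euclOp (c (k, 1)) v :=
    sub_eq_zero.mp ((smul_eq_zero.mp h).resolve_left (by norm_num))
  rw [modeParity, euclOp_smul, euclOp_mul, ← map_smul, ← h1, ← euclOp_mul, hc.mul_self, euclOp_one]

theorem euclOp_lambdaOp_of_isGaussianVacuum (ha : IsFermionicModes a) {v : EuclideanSpace ℂ n}
    (hv : IsGaussianVacuum a v) : euclOp (lambdaOp (majorana a)) (tensorVec v v) = 0 := by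
  obtain ⟨-, R, hR, hv⟩ := hv
  rw [← lambdaOp_rotated (majorana a) hR]
  exact (ha.isCliffordFamily.rotated_orthogonal hR).euclOp_lambdaOp_tensorVec fun k =>
    ⟨1, one_mul 1, by rw [modeParity_of_isGaussianVacuum ha hR (hv k), one_smul]⟩

theorem exists_isGaussianVacuum (hn : Fintype.card n = 2 ^ m) (ha : IsFermionicModes a) :
    ∃ v : EuclideanSpace ℂ n, IsGaussianVacuum a v := by
  have hc := ha.isCliffordFamily
  obtain ⟨b, hb⟩ := (hc.isQubitFamily_modeParity hn).exists_orthonormalBasis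
  have hrot : rotated (1 : Matrix (Fin m × Fin 2) (Fin m × Fin 2) ℝ) (majorana a) = majorana a := by
    funext i
    rw [← Matrix.diagonal_one, rotated_diagonal]
    simp
  refine ⟨b Finset.univ, b.orthonormal.1 _, 1, one_mem _, fun k => ?_⟩
  have h1 : euclOp (modeParity (majorana a) k) (b Finset.univ) = (1 : ℂ) • b Finset.univ := by
    rw [hb]
    simp [memSign]
  have h2 := hc.euclOp_fst_of_modeParity h1 (one_mul 1)
  rw [← ofLp_euclOp, rotatedAnnihilation, hrot, euclOp_smul, euclOp_sub, euclOp_smul, h2]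
  simp

theorem modeParity_commute_gaussian (hc : IsCliffordFamily c) (l : Fin m → ℂ) (j : Fin m) :
    modeParity c j * (List.ofFn fun k : Fin m =>
      (1 : Matrix n n ℂ) + l k • (c (k, 0) * c (k, 1))).prod =
    (List.ofFn fun k : Fin m =>
      (1 : Matrix n n ℂ) + l k • (c (k, 0) * c (k, 1))).prod * modeParity c j := by
  refine Commute.list_prod_right _ _ fun x hx => ?_
  obtain ⟨k, rfl⟩ := (List.mem_ofFn' _ _).mp hx
  refine (Commute.one_right _).add_right (Commute.smul_right ?_ _)
  by_cases h : k = j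
  · subst h
    exact (Commute.refl _).smul_left _
  · have hcomm : ∀ x, Commute (modeParity c j) (c (k, x)) := fun x => hc.modeParity_commute h
    exact (hcomm 0).mul_right (hcomm 1)

/-- |ψ⟩⟨ψ| commutes with the mode parities appearing in its standard form, so ψ is an eigenvector of
each. The values of the λ_k play no role. -/
theorem IsPureGaussian.euclOp_lambdaOp (ha : IsFermionicModes a) (hn : Fintype.card n = 2 ^ m)
    {ψ : EuclideanSpace ℂ n} (hψ : IsPureGaussian a ψ) :
    euclOp (lambdaOp (majorana a)) (tensorVec ψ ψ) = 0 := by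
  obtain ⟨hψ1, R, hR, l, -, hρ⟩ := hψ
  have hRO := (Matrix.mem_specialOrthogonalGroup_iff.mp hR).1
  have hc := ha.isCliffordFamily.rotated_orthogonal hRO
  rw [← lambdaOp_rotated (majorana a) hRO]
  set c := rotated R (majorana a)
  refine hc.euclOp_lambdaOp_tensorVec fun k => ?_
  have hcomm : modeParity c k * ketBra ψ = ketBra ψ * modeParity c k := by
    rw [hρ, Matrix.mul_smul, Matrix.smul_mul, modeParity_commute_gaussian hc]
  have hψψ : inner ℂ ψ ψ = (1 : ℂ) := by
    rw [inner_self_eq_norm_sq_to_K, hψ1]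
    simp
  have hZ : euclOp (modeParity c k) ψ = inner ℂ ψ (euclOp (modeParity c k) ψ) • ψ := by
    have h := congrArg (fun M => euclOp M ψ) hcomm
    simp only [euclOp_mul, euclOp_ketBra, hψψ, one_smul] at h
    exact h
  refine ⟨_, ?_, hZ⟩
  set s : ℂ := inner ℂ ψ (euclOp (modeParity c k) ψ)
  have h2 : ψ = (s * s) • ψ := by
    rw [mul_smul, ← hZ, ← map_smul, ← hZ, ← euclOp_mul,
      (hc.isQubitFamily_modeParity hn).mul_self, euclOp_one]
  have h3 := congrArg (inner ℂ ψ) h2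
  rw [inner_smul_right, hψψ, mul_one] at h3
  exact h3.symm

/-- Every joint eigenvector of rotated mode parities is pure Gaussian, also for improper
rotations. -/
theorem isPureGaussian_of_modeParity (ha : IsFermionicModes a) (hn : Fintype.card n = 2 ^ m)
    {R : Matrix _ _ ℝ} (hR : R ∈ Matrix.orthogonalGroup (Fin m × Fin 2) ℝ)
    {w : EuclideanSpace ℂ n} (hw1 : ‖w‖ = 1)
    (hw : ∀ k, euclOp (modeParity (rotated R (majorana a)) k) w = w) : IsPureGaussian a w := by
  refine ⟨hw1, ?_⟩
  have hdet : R.det = 1 ∨ R.det = -1 := by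
    have h := congrArg Matrix.det ((Matrix.mem_orthogonalGroup_iff _ ℝ).mp hR)
    rw [Matrix.det_mul, Matrix.det_transpose, Matrix.det_one] at h
    exact mul_self_eq_one_iff.mp h
  rcases hdet with hdet | hdet
  · refine ⟨R, Matrix.mem_specialOrthogonalGroup_iff.mpr ⟨hR, hdet⟩, fun _ => 1, fun _ => by simp, ?_⟩
    exact (ha.isCliffordFamily.rotated_orthogonal hR).ketBra_eq_of_modeParity hn hw1
      (fun _ => Or.inl rfl) (fun k => by rw [hw, Complex.ofReal_one, one_smul])
  -- For m = 0 the determinant is 1, so an improper rotation provides at least one mode.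
  · have hm : Nonempty (Fin m) := by
      by_contra h
      rw [not_nonempty_iff] at h
      rw [Matrix.det_isEmpty] at hdet
      norm_num at hdet
    obtain ⟨k₀⟩ := hm
    -- Negating one Majorana operator of mode k₀ makes the rotation proper and reverses that parity,
    -- which λ = -1 at k₀ compensates.
    set d : Fin m × Fin 2 → ℝ := fun i => if i = (k₀, 1) then -1 else 1 with hd
    have hD : Matrix.diagonal d ∈ Matrix.orthogonalGroup (Fin m × Fin 2) ℝ :=
      diagonal_mem_orthogonalGroup fun i => by simp only [hd]; split_ifs <;> norm_num
    have hDdet : (Matrix.diagonal d).det = -1 := by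
      rw [Matrix.det_diagonal, hd, Finset.prod_ite_eq' Finset.univ (k₀, (1 : Fin 2)) fun _ => (-1 : ℝ)]
      simp
    have hDR := mul_mem hD hR
    refine ⟨Matrix.diagonal d * R, Matrix.mem_specialOrthogonalGroup_iff.mpr ⟨hDR, ?_⟩,
      fun k => if k = k₀ then -1 else 1, fun k => by
        by_cases h : k = k₀ <;> simp [h], ?_⟩
    · rw [Matrix.det_mul, hDdet, hdet]
      norm_num
    · refine (ha.isCliffordFamily.rotated_orthogonal hDR).ketBra_eq_of_modeParity hn hw1
        (fun k => by by_cases h : k = k₀ <;> simp [h]) (fun k => ?_)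
      have hpar : modeParity (rotated (Matrix.diagonal d * R) (majorana a)) k =
          ((if k = k₀ then -1 else 1 : ℝ) : ℂ) • modeParity (rotated R (majorana a)) k := by
        rw [modeParity, modeParity, rotated_mul, rotated_diagonal, rotated_diagonal,
          Matrix.smul_mul, Matrix.mul_smul, smul_smul, smul_smul, smul_smul]
        congr 1
        by_cases h : k = k₀ <;> simp [hd, h]
      rw [hpar, euclOp_smul, hw]

/-- For the hard inclusion, every value of the twirl integrand is a rank-one operator with range in
the span, so the range of the twirl, hence of the projector, lies there too. -/
theorem span_eq_lambdaNullSpace_of_floTwirl (ha : IsFermionicModes a)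
    (hn : Fintype.card n = 2 ^ m)
    {U : Matrix.orthogonalGroup (Fin m × Fin 2) ℝ → Matrix.unitaryGroup n ℂ}
    (hU : ∀ R, Induces (majorana a) (U R) R) {v : EuclideanSpace ℂ n}
    (hv : IsGaussianVacuum a v) {r : ℂ}
    (hproj : (lambdaNullSpace (majorana a)).starProjection =
      euclOp (r • floTwirl U (ketBra (tensorVec v v)))) :
    Submodule.span ℂ {x | ∃ ψ : EuclideanSpace ℂ n, IsPureGaussian a ψ ∧ x = tensorVec ψ ψ} =
      lambdaNullSpace (majorana a) := by
  have hc := ha.isCliffordFamily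
  have hι := even_card_majorana_index m
  have hn2 := card_sq_eq_two_pow hn
  apply le_antisymm
  · rw [Submodule.span_le]
    rintro x ⟨ψ, hψ, rfl⟩
    exact hψ.euclOp_lambdaOp ha hn
  · set W := Submodule.span ℂ {x | ∃ ψ : EuclideanSpace ℂ n, IsPureGaussian a ψ ∧
      x = tensorVec ψ ψ} with hW
    obtain ⟨hv1, Q, hQ, hvQ⟩ := hv
    have hUv : ∀ R, IsPureGaussian a (euclOp (U R : Matrix n n ℂ) v) := by
      intro R
      -- U_R v has parity +1 in every mode rotated by Q R, which may be improper.
      refine isPureGaussian_of_modeParity ha hn (mul_mem hQ R.2)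
        (by rw [norm_euclOp_unitary, hv1]) fun k => ?_
      have hconj : ∀ i, rotated (Q * (R : Matrix _ _ ℝ)) (majorana a) i * (U R : Matrix n n ℂ) =
          U R * rotated Q (majorana a) i := by
        intro i
        have h : (U R : Matrix n n ℂ) * rotated Q (majorana a) i * (U R : Matrix n n ℂ)ᴴ =
            rotated (Q * (R : Matrix _ _ ℝ)) (majorana a) i := by
          rw [rotated_mul, rotated, rotated, Finset.mul_sum, Finset.sum_mul]
          simp only [Matrix.mul_smul, Matrix.smul_mul, hU R _]
        rw [← h, mul_assoc, conjTranspose_mul_unitary, mul_one]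
      have hpar : modeParity (rotated (Q * (R : Matrix _ _ ℝ)) (majorana a)) k * (U R : Matrix n n ℂ) =
          U R * modeParity (rotated Q (majorana a)) k := by
        rw [modeParity, modeParity, Matrix.smul_mul, Matrix.mul_smul, mul_assoc, hconj,
          ← mul_assoc, hconj, mul_assoc]
      rw [← euclOp_mul, hpar, euclOp_mul, modeParity_of_isGaussianVacuum ha hQ (hvQ k)]
    obtain ⟨P, hP⟩ : ∃ P : Matrix (n × n) (n × n) ℂ, euclOp P = W.starProjection :=
      (Matrix.toEuclideanCLM (n := n × n) (𝕜 := ℂ)).surjective _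
    -- The projection P onto W fixes each value of the integrand, hence the integral.
    have hPS := hc.mul_floTwirl hι hn2 hU (ketBra (tensorVec v v)) (A := P) (B := 1) fun R => by
      have h : twirlIntegrand U (ketBra (tensorVec v v)) R = ketBra (tensorVec
          (euclOp (U R : Matrix n n ℂ) v) (euclOp (U R : Matrix n n ℂ) v)) :=
        conjTwoCopies_ketBra_tensorVec _ v
      rw [h, one_mul]
      apply euclOp_injective
      ext1 y
      rw [euclOp_mul, euclOp_ketBra, map_smul, hP]
      congr 1
      exact Submodule.starProjection_eq_self_iff.mpr (Submodule.subset_span ⟨_, hUv R, rfl⟩)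
    intro x hx
    rw [← Submodule.starProjection_eq_self_iff.mpr hx, hproj, euclOp_smul]
    refine W.smul_mem r ?_
    rw [one_mul] at hPS
    rw [← hPS, euclOp_mul, hP]
    exact Submodule.starProjection_apply_mem _ _

omit [DecidableEq n] in
theorem span_tensorVec_self_le_symmetricSubspace (s : Set (EuclideanSpace ℂ n)) :
    Submodule.span ℂ {x | ∃ ψ, ψ ∈ s ∧ x = tensorVec ψ ψ} ≤ symmetricSubspace n := by
  rw [Submodule.span_le]
  rintro x ⟨ψ, -, rfl⟩
  change swapOp n (tensorVec ψ ψ) = tensorVec ψ ψ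
  ext p
  simp [swapOp, tensorVec, mul_comm]

end Gaussian

/-! ### The theorem -/

theorem mainTheorem5 {m : ℕ} {n : Type*} [Fintype n] [DecidableEq n]
    (hn : Fintype.card n = 2 ^ m) (a : Fin m → Matrix n n ℂ) (ha : IsFermionicModes a) :
    -- every orthogonal matrix is induced by a unitary
    (∀ R : Matrix.orthogonalGroup (Fin m × Fin 2) ℝ,
      ∃ U : Matrix.unitaryGroup n ℂ, Induces (majorana a) U R) ∧
    -- for every choice of inducing unitaries the twirl is well defined, and the formula for the
    -- orthogonal projector onto the null space holds
    (∀ U : Matrix.orthogonalGroup (Fin m × Fin 2) ℝ → Matrix.unitaryGroup n ℂ,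
      (∀ R, Induces (majorana a) (U R) R) →
      (∀ (X : Matrix (n × n) (n × n) ℂ) (p q : n × n), MeasureTheory.Integrable
        (fun R => twirlIntegrand U X R p q) (orthogonalHaar (Fin m × Fin 2))) ∧
      ∀ v : EuclideanSpace ℂ n, IsGaussianVacuum a v →
        (lambdaNullSpace (majorana a)).starProjection =
          Matrix.toEuclideanCLM (n := n × n) (𝕜 := ℂ)
            (((2 * m).choose m : ℂ) • floTwirl U (ketBra (tensorVec v v)))) ∧
    -- the null space is spanned by two copies of pure Gaussian states
    Submodule.span ℂ {x | ∃ ψ : EuclideanSpace ℂ n, IsPureGaussian a ψ ∧ x = tensorVec ψ ψ} =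
      lambdaNullSpace (majorana a) ∧
    -- the null space lies inside the symmetric subspace
    lambdaNullSpace (majorana a) ≤ symmetricSubspace n := by
  have hc := ha.isCliffordFamily
  have hι := even_card_majorana_index m
  have hn2 := card_sq_eq_two_pow hn
  have hproj : ∀ U : Matrix.orthogonalGroup (Fin m × Fin 2) ℝ → Matrix.unitaryGroup n ℂ,
      (∀ R, Induces (majorana a) (U R) R) → ∀ v : EuclideanSpace ℂ n, IsGaussianVacuum a v →
        (lambdaNullSpace (majorana a)).starProjection =
          euclOp (((2 * m).choose m : ℂ) • floTwirl U (ketBra (tensorVec v v))) := by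
    intro U hU v hv
    refine hc.starProjection_lambdaNullSpace_eq (by simp [mul_comm]) hn2
      (fun Q W hW => hc.conjTwoCopies_floTwirl hι hn2 hU _ hW) ?_ ?_
    · rw [hc.mul_floTwirl hι hn2 hU _ (B := 0), zero_mul]
      intro R
      -- Conjugation by U_R ⊗ U_R rotates the generators inside Λ, and Λ is unchanged by rotation.
      have hΛU : lambdaOp (majorana a) * ((U R : Matrix n n ℂ) ⊗ₖ (U R : Matrix n n ℂ)) =
          ((U R : Matrix n n ℂ) ⊗ₖ (U R : Matrix n n ℂ)) * lambdaOp (majorana a) := by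
        rw [← lambdaOp_rotated (majorana a) R.2]
        conv_rhs => rw [lambdaOp_rotated (majorana a) R.2]
        simp only [lambdaOp, Finset.sum_mul, Finset.mul_sum, ← Matrix.mul_kronecker_mul]
        refine Finset.sum_congr rfl fun i _ => ?_
        rw [← hU R i, mul_assoc, conjTranspose_mul_unitary, mul_one]
      have hΛX : lambdaOp (majorana a) * ketBra (tensorVec v v) = 0 := by
        apply euclOp_injective
        ext1 y
        rw [euclOp_mul, euclOp_ketBra, map_smul, euclOp_lambdaOp_of_isGaussianVacuum ha hv,
          smul_zero, euclOp_zero]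
      rw [twirlIntegrand, ← mul_assoc, ← mul_assoc, hΛU, mul_assoc _ (lambdaOp (majorana a)), hΛX]
      simp
    · rw [hc.trace_floTwirl hι hn2 hU, trace_ketBra, inner_tensorVec_self,
        inner_self_eq_norm_sq_to_K, hv.1]
      simp
  -- The last two claims involve no twirl, so one choice of unitaries and one vacuum suffice.
  choose U₀ hU₀ using hc.exists_induces hι hn2
  obtain ⟨v₀, hv₀⟩ := exists_isGaussianVacuum hn ha
  have hspan := span_eq_lambdaNullSpace_of_floTwirl ha hn hU₀ hv₀ (hproj U₀ hU₀ v₀ hv₀)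
  refine ⟨hc.exists_induces hι hn2, fun U hU =>
    ⟨hc.integrable_twirlIntegrand hι hn2 hU, hproj U hU⟩, hspan, ?_⟩
  rw [← hspan]
  exact span_tensorVec_self_le_symmetricSubspace {ψ | IsPureGaussian a ψ}
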